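/- The Rendezvous Game with Adversaries is played on a finite simple connected graph $G$ by two players with complete information. Facilitator has two agents, initially in given vertices $s$ and $t$. Divider has $k\ge 1$ agents, which he first places in vertices of $V(G)\setminus\{s,t\}$ (several of them may share a vertex). Then the players move by turns, Facilitator first: in a move the player moves some of his agents to adjacent vertices and keeps the others in place, and no agent may be moved to a vertex that is occupied by an agent of the adversary. Facilitator wins if his two agents are at some moment in the same vertex; Divider wins if this never happens. The problem RENDEZVOUS asks, given $G$, $s,t\in V(G)$ and a positive integer $k$, whether Facilitator can win, that is, whether he has a strategy that wins against every strategy of Divider with $k$ agents. A graph is $P_5$-free if it has no induced subgraph isomorphic to the path on 5 vertices, and chordal if it has no induced cycle on at least 4 vertices. Corollary. RENDEZVOUS can be solved in polynomial time on the class of $P_5$-free graphs and on the class of chordal graphs: for each of the two classes there is an algorithm that, for every connected graph $G$ of the class (given by its adjacency matrix), all $s,t\in V(G)$ and every integer $k\ge 1$ (given in binary), decides whether Facilitator can win, in a number of steps bounded by a polynomial in the size of the input. (Algorithms are programs for a random access machine with addition and subtraction, without multiplication, at unit cost.) -/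

import Mathlib

/-! ## Graph classes -/

/-- `G` has no induced subgraph isomorphic to the path on five vertices. -/
def SimpleGraph.P5Free {V : Type*} (G : SimpleGraph V) : Prop :=
  ¬ (SimpleGraph.pathGraph 5).IsIndContained G

/-- `G` has no induced cycle on at least four vertices. -/
def SimpleGraph.Chordal {V : Type*} (G : SimpleGraph V) : Prop :=
  ∀ m : ℕ, 4 ≤ m → ¬ (SimpleGraph.cycleGraph m).IsIndContained G

/-! ## The rendezvous game with adversaries -/

namespace Rendezvous

/-- Two placements of `m` agents (multisets of `m` vertices) are adjacent if there is a bijection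
between them that sends every vertex to itself or to a neighbour: the agents can get from `X` to
`Y` in one move. -/
def Adjacent {V : Type*} (G : SimpleGraph V) {m : ℕ} (X Y : Sym V m) : Prop :=
  Multiset.Rel (fun x y => x = y ∨ G.Adj x y) (X : Multiset V) (Y : Multiset V)

/-- No vertex is occupied by agents of both players. -/
def Compatible {V : Type*} {k : ℕ} (F : Sym V 2) (D : Sym V k) : Prop :=
  ∀ v : V, v ∈ F → v ∉ D

/-- The placement of Facilitator's two agents in `s` and `t`. -/
def pair {V : Type*} (s t : V) : Sym V 2 :=
  ⟨{s, t}, Multiset.card_pair s t⟩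

/-- Facilitator's two agents are in the same vertex. -/
def Meet {V : Type*} (F : Sym V 2) : Prop :=
  ∃ x : V, F = pair x x

/-- A strategy of Facilitator against `k` agents of Divider: it assigns to every position a legal
move. Its values on pairs that are not compatible are irrelevant. -/
structure FacilitatorStrategy {V : Type*} (G : SimpleGraph V) (k : ℕ) where
  /-- the new placement of Facilitator's agents -/
  move : Sym V 2 → Sym V k → Sym V 2
  adjacent : ∀ F D, Compatible F D → Adjacent G F (move F D)
  compatible : ∀ F D, Compatible F D → Compatible (move F D) D

/-- A strategy of Divider with `k` agents against Facilitator starting from `s` and `t`: an initial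
placement outside of `{s, t}`, and a legal move for every position. -/
structure DividerStrategy {V : Type*} (G : SimpleGraph V) (s t : V) (k : ℕ) where
  /-- the initial placement of Divider's agents -/
  init : Sym V k
  init_compatible : Compatible (pair s t) init
  /-- the new placement of Divider's agents -/
  move : Sym V 2 → Sym V k → Sym V k
  adjacent : ∀ F D, Compatible F D → Adjacent G D (move F D)
  compatible : ∀ F D, Compatible F D → Compatible F (move F D)

/-- The position after `i` rounds; in every round Facilitator moves first. -/
def play {V : Type*} {G : SimpleGraph V} {s t : V} {k : ℕ}
    (f : FacilitatorStrategy G k) (d : DividerStrategy G s t k) : ℕ → Sym V 2 × Sym V k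
  | 0 => (pair s t, d.init)
  | i + 1 =>
    let F := f.move (play f d i).1 (play f d i).2
    (F, d.move F (play f d i).2)

/-- Facilitator can win on `G` starting from `s` and `t` against Divider with `k` agents: he has a
strategy with which his agents meet, whatever Divider does. -/
def FacilitatorWins {V : Type*} (G : SimpleGraph V) (s t : V) (k : ℕ) : Prop :=
  ∃ f : FacilitatorStrategy G k, ∀ d : DividerStrategy G s t k, ∃ i : ℕ, Meet (play f d i).1

end Rendezvous

/-! ## Random access machines

Structured programs for a random access machine with registers, an indirectly addressed memory, and
addition and truncated subtraction as its arithmetic. Every instruction and every test takes one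
step. There is no multiplication, so a step makes the longest number at most one bit longer (apart
from the finitely many constants in the program), and polynomial time for these machines is
polynomial time for Turing machines. -/

namespace RAM

/-- The contents of the registers and of the memory. -/
structure State where
  reg : ℕ → ℕ
  mem : ℕ → ℕ

/-- Write the number `a` to the register `x`. -/
def State.setReg (σ : State) (x a : ℕ) : State :=
  { σ with reg := Function.update σ.reg x a }

/-- Write the number `a` to the memory cell `i`. -/
def State.setMem (σ : State) (i a : ℕ) : State :=
  { σ with mem := Function.update σ.mem i a }

/-- Programs; `x y z` are registers. -/
inductive Prog where
  /-- do nothing -/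
  | skip
  /-- `x := c` -/
  | const (x c : ℕ)
  /-- `x := y` -/
  | copy (x y : ℕ)
  /-- `x := y + z` -/
  | add (x y z : ℕ)
  /-- `x := max (y - z) 0` -/
  | sub (x y z : ℕ)
  /-- `x := mem[y]` -/
  | load (x y : ℕ)
  /-- `mem[x] := y` -/
  | store (x y : ℕ)
  /-- first `p`, then `q` -/
  | seq (p q : Prog)
  /-- if `x ≠ 0` then `p` else `q` -/
  | ite (x : ℕ) (p q : Prog)
  /-- while `x ≠ 0` do `p` -/
  | loop (x : ℕ) (p : Prog)

/-- `Exec p σ T σ'`: started in the state `σ`, the program `p` halts after exactly `T` steps in the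
state `σ'`. -/
inductive Exec : Prog → State → ℕ → State → Prop where
  | skip (σ : State) : Exec .skip σ 1 σ
  | const (σ : State) (x c : ℕ) : Exec (.const x c) σ 1 (σ.setReg x c)
  | copy (σ : State) (x y : ℕ) : Exec (.copy x y) σ 1 (σ.setReg x (σ.reg y))
  | add (σ : State) (x y z : ℕ) : Exec (.add x y z) σ 1 (σ.setReg x (σ.reg y + σ.reg z))
  | sub (σ : State) (x y z : ℕ) : Exec (.sub x y z) σ 1 (σ.setReg x (σ.reg y - σ.reg z))
  | load (σ : State) (x y : ℕ) : Exec (.load x y) σ 1 (σ.setReg x (σ.mem (σ.reg y)))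
  | store (σ : State) (x y : ℕ) : Exec (.store x y) σ 1 (σ.setMem (σ.reg x) (σ.reg y))
  | seq {p q : Prog} {σ σ' σ'' : State} {T T' : ℕ} (hp : Exec p σ T σ') (hq : Exec q σ' T' σ'') :
      Exec (.seq p q) σ (T + T') σ''
  | ite_true {x : ℕ} {p q : Prog} {σ σ' : State} {T : ℕ} (hx : σ.reg x ≠ 0) (hp : Exec p σ T σ') :
      Exec (.ite x p q) σ (T + 1) σ'
  | ite_false {x : ℕ} {p q : Prog} {σ σ' : State} {T : ℕ} (hx : σ.reg x = 0) (hq : Exec q σ T σ') :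
      Exec (.ite x p q) σ (T + 1) σ'
  | loop_stop {x : ℕ} {p : Prog} {σ : State} (hx : σ.reg x = 0) : Exec (.loop x p) σ 1 σ
  | loop_step {x : ℕ} {p : Prog} {σ σ' σ'' : State} {T T' : ℕ} (hx : σ.reg x ≠ 0)
      (hp : Exec p σ T σ') (hl : Exec (.loop x p) σ' T' σ'') :
      Exec (.loop x p) σ (T + T' + 1) σ''

end RAM

/-! ## The decision problem -/

namespace Rendezvous

open Classical in
/-- The instance `(G, s, t, k)` as an input of a machine: the registers `0, 1, 2, 3` hold
`n, s, t, k`, the memory holds the adjacency matrix row by row, and all else is zero. -/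
noncomputable def input {n : ℕ} (G : SimpleGraph (Fin n)) (s t : Fin n) (k : ℕ) : RAM.State where
  reg
    | 0 => n
    | 1 => s
    | 2 => t
    | 3 => k
    | _ => 0
  mem a := if ∃ u v : Fin n, a = u.val * n + v.val ∧ G.Adj u v then 1 else 0

/-- The number of bits of the input: the adjacency matrix, and `n, s, t, k` in binary. -/
def inputSize {n : ℕ} (s t : Fin n) (k : ℕ) : ℕ :=
  n ^ 2 + n.size + s.val.size + t.val.size + k.size

open Classical in
/-- The problem Rendezvous can be solved in polynomial time on the graph class `C`: for a fixed
program and a fixed polynomial, on every instance with a connected graph from `C` and a positive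
number of agents of Divider, the program halts within the given number of steps and leaves the
answer (`1` if Facilitator can win, `0` if not) in the register `0`. -/
def SolvableInPolyTimeOn (C : ∀ n : ℕ, SimpleGraph (Fin n) → Prop) : Prop :=
  ∃ (p : RAM.Prog) (B : Polynomial ℕ),
    ∀ (n : ℕ) (G : SimpleGraph (Fin n)) (s t : Fin n) (k : ℕ), G.Connected → C n G → 0 < k →
      ∃ (T : ℕ) (σ : RAM.State), RAM.Exec p (input G s t k) T σ ∧
        T ≤ B.eval (inputSize s t k) ∧
        σ.reg 0 = if FacilitatorWins G s t k then 1 else 0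

end Rendezvous

/-! On both classes Facilitator wins exactly when no `k` vertices separate `s` from `t` (`NoCut`).
If some do, Divider occupies them and never moves (`FacilitatorWins.noCut`).

Conversely, in a P5-free graph a shortest path that avoids Divider's agents is induced, so its
length is at most 3. One move along it makes the agents meet or become adjacent, and adjacent agents
can always meet. In a chordal graph, the neighbours of `s` that border the component of `t` in `G -
N[s]` separate `s` from `t` and form a clique. Divider cannot fill this barrier, so an agent moves
from `s` to a free vertex `v` of it. Through the clique, `v` reaches every path from `t` to `s`, so
`v` and `t` are again inseparable, and the component of `t` has shrunk (`Chordal.noCut_of_barrier`,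
`Chordal.farSide_ssubset`).

It remains to decide `NoCut` for distinct nonadjacent `s` and `t`, by building `k + 1` disjoint
paths. A vertex on a path is owned by its predecessor, an idle vertex by itself; stray cycles do no
harm. A vertex without property takes a cheapest vertex of its closed neighbourhood, raises its
price by one, and the former owner bids next. Choosing `t` completes a path, and `s` bids again.
Either more than `k` paths are completed, or the bidder sees only prices of at least `n`, and a gap
between the prices reveals a cut. Counting certifies both outcomes (`Auction.noCut`,
`Auction.not_noCut`), without Menger's theorem. Prices are at most `n`, so there are `O(n ^ 2)`
rounds of `O(n)` steps. -/

namespace SimpleGraph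

/-! ### Geodesics outside a vertex set; induced paths and cycles -/

variable {V : Type*}

/-- The graph `G` without the edges that have an end in `S`. -/
def avoid (G : SimpleGraph V) (S : Set V) : SimpleGraph V where
  Adj x y := G.Adj x y ∧ x ∉ S ∧ y ∉ S
  symm := ⟨fun _ _ h => ⟨h.1.symm, h.2.2, h.2.1⟩⟩
  loopless := ⟨fun _ h => G.loopless.irrefl _ h.1⟩

theorem avoid_adj {G : SimpleGraph V} {S : Set V} {x y : V} :
    (G.avoid S).Adj x y ↔ G.Adj x y ∧ x ∉ S ∧ y ∉ S := Iff.rfl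

theorem isIndContained_of_forall {W : Type*} {G : SimpleGraph V} {H : SimpleGraph W} (f : W → V)
    (hf : f.Injective) (h : ∀ i j, G.Adj (f i) (f j) ↔ H.Adj i j) : H.IsIndContained G :=
  ⟨⟨⟨f, hf⟩, h _ _⟩⟩

/-- A property that is preserved along edges is preserved by reachability. -/
theorem Reachable.of_closed {G : SimpleGraph V} {x y : V} (h : G.Reachable x y) {P : V → Prop}
    (hx : P x) (hP : ∀ a b, G.Adj a b → P a → P b) : P y := by
  rw [reachable_iff_reflTransGen] at h
  induction h with
  | refl => exact hx
  | tail _ hab ih => exact hP _ _ hab ih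

theorem Reachable.notMem_of_avoid {G : SimpleGraph V} {S : Set V} {x y : V}
    (h : (G.avoid S).Reachable x y) (hx : x ∉ S) : y ∉ S :=
  h.of_closed hx fun _ _ hab _ => hab.2.2

/-- Reachable vertices are joined by an induced path. -/
theorem Reachable.exists_geodesic {G : SimpleGraph V} {a b : V} (h : G.Reachable a b) :
    ∃ v : ℕ → V, v 0 = a ∧ v (G.dist a b) = b ∧
      (∀ i < G.dist a b, G.Adj (v i) (v (i + 1))) ∧ (∀ i, G.Reachable a (v i)) ∧
      ∀ i ≤ G.dist a b, G.dist a (v i) = i := by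
  obtain ⟨p, hp⟩ := h.exists_walk_length_eq_dist
  have hr : ∀ i, G.Reachable a (p.getVert i) := fun i => ⟨p.take i⟩
  refine ⟨p.getVert, p.getVert_zero, by rw [← hp, p.getVert_length],
    fun i hi => p.adj_getVert_succ (by omega), hr, ?_⟩
  intro i hi
  apply le_antisymm
  · exact (dist_le (p.take i)).trans (by simp)
  · have h1 := (hr i).dist_triangle_left b
    have h2 := dist_le (p.drop i)
    simp at h2
    omega

theorem dist_le_of_adj {G : SimpleGraph V} {a x y : V} (h : G.Adj x y) :
    G.dist a x ≤ G.dist a y + 1 ∧ G.dist a y ≤ G.dist a x + 1 := by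
  have := h.diff_dist_adj (u := a)
  omega

/-- Edges of `G` between vertices outside `S` survive in `G.avoid S`, so a geodesic there is induced
in `G`; five vertices of a longer one would induce a path. -/
theorem Reachable.dist_le_three_of_P5Free {G : SimpleGraph V} (hG : G.P5Free) {S : Set V} {a b : V}
    (ha : a ∉ S) (h : (G.avoid S).Reachable a b) : (G.avoid S).dist a b ≤ 3 := by
  by_contra! hl
  obtain ⟨v, -, -, hadj, hr, hd⟩ := h.exists_geodesic
  have hS : ∀ i, v i ∉ S := fun i => (hr i).notMem_of_avoid ha
  refine hG (isIndContained_of_forall (fun i : Fin 5 => v i) (fun i j hij => ?_) fun i j => ?_)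
  · have h1 := hd i (by omega)
    have h2 := hd j (by omega)
    simp only at hij
    rw [hij] at h1
    exact Fin.ext (h1.symm.trans h2)
  · simp only [pathGraph_adj]
    constructor
    · intro hij
      have h1 := hd i (by omega)
      have h2 := hd j (by omega)
      have := dist_le_of_adj (a := a) (avoid_adj.2 ⟨hij, hS i, hS j⟩)
      have hne : i.val ≠ j.val := fun e => G.ne_of_adj hij (by rw [e])
      omega
    · rintro (e | e)
      · have := (hadj i (by omega)).1
        rwa [e] at this
      · have := (hadj j (by omega)).1.symm
        rwa [e] at this

/-- In a chordal graph, two neighbours of `s` that are joined by a path outside of the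
neighbourhood of `s` are adjacent. -/
theorem Chordal.adj_of_reachable {G : SimpleGraph V} (hG : G.Chordal) {s a b : V} {C : Set V}
    (hC : ∀ x ∈ C, x ≠ s ∧ ¬ G.Adj s x) (ha : G.Adj s a) (hb : G.Adj s b) (hab : a ≠ b)
    (h : (G.avoid (C ∪ {a, b})ᶜ).Reachable a b) : G.Adj a b := by
  by_contra hnadj
  set H := G.avoid (C ∪ {a, b})ᶜ with hH
  obtain ⟨v, v0, vl, hadj, hr, hd⟩ := h.exists_geodesic
  have hS : ∀ i, v i ∉ (C ∪ {a, b})ᶜ := fun i => (hr i).notMem_of_avoid (by simp)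
  have hl : 1 < H.dist a b := h.one_lt_dist_of_ne_of_not_adj hab fun e => hnadj e.1
  set l := H.dist a b with hldef
  have hinj : ∀ i ≤ l, ∀ j ≤ l, v i = v j → i = j := by
    intro i hi j hj e
    rw [← hd i hi, ← hd j hj, e]
  have hsv : ∀ i ≤ l, v i ≠ s ∧ (G.Adj s (v i) ↔ i = 0 ∨ i = l) := by
    intro i hi
    have := hS i
    simp only [Set.mem_compl_iff, Set.mem_union, Set.mem_insert_iff, Set.mem_singleton_iff,
      not_not] at this
    rcases this with hc | hc | hc
    · refine ⟨(hC _ hc).1, ⟨fun e => absurd e (hC _ hc).2, ?_⟩⟩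
      rintro (rfl | rfl)
      · rwa [v0]
      · rwa [vl]
    · exact ⟨by rw [hc]; exact ha.ne', by
        rw [hc]; exact ⟨fun _ => .inl (hinj i hi 0 (by omega) (by rw [hc, v0])), fun _ => ha⟩⟩
    · exact ⟨by rw [hc]; exact hb.ne', by
        rw [hc]; exact ⟨fun _ => .inr (hinj i hi l le_rfl (by rw [hc, vl])), fun _ => hb⟩⟩
  have hvv : ∀ i ≤ l, ∀ j ≤ l, G.Adj (v i) (v j) ↔ i + 1 = j ∨ j + 1 = i := by
    intro i hi j hj
    constructor
    · intro hij
      have h1 := hd i hi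
      have h2 := hd j hj
      have : H.dist a (v i) ≤ H.dist a (v j) + 1 ∧ H.dist a (v j) ≤ H.dist a (v i) + 1 :=
        dist_le_of_adj (avoid_adj.2 ⟨hij, hS i, hS j⟩)
      have hne : i ≠ j := fun e => G.ne_of_adj hij (by rw [e])
      omega
    · rintro (rfl | rfl)
      · exact (hadj i (by omega)).1
      · exact (hadj j (by omega)).1.symm
  -- The geodesic `v 0, ..., v l` closed up by `s` is an induced cycle; it has at least four
  -- vertices because `l ≥ 2`.
  refine hG (l + 2) (by omega)
    (isIndContained_of_forall (fun i : Fin (l + 2) => if i.val ≤ l then v i else s)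
      (fun i j hij => ?_) fun i j => ?_)
  · simp only at hij
    apply Fin.ext
    split_ifs at hij with h1 h2 h2
    · exact hinj _ h1 _ h2 hij
    · exact absurd hij (hsv _ h1).1
    · exact absurd hij.symm (hsv _ h2).1
    · omega
  · simp only [cycleGraph_adj']
    have hi := i.isLt
    have hj := j.isLt
    have e1 : (i - j).val = if j.val ≤ i.val then i.val - j.val else l + 2 + i.val - j.val := by
      split_ifs with hle
      · exact Fin.sub_val_of_le hle
      · rw [Fin.coe_sub_iff_lt.2 (by rw [Fin.lt_def]; omega)]
    have e2 : (j - i).val = if i.val ≤ j.val then j.val - i.val else l + 2 + j.val - i.val := by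
      split_ifs with hle
      · exact Fin.sub_val_of_le hle
      · rw [Fin.coe_sub_iff_lt.2 (by rw [Fin.lt_def]; omega)]
    rw [e1, e2]
    by_cases h1 : i.val ≤ l <;> by_cases h2 : j.val ≤ l
    · rw [if_pos h1, if_pos h2, hvv _ h1 _ h2]
      split_ifs <;> omega
    · rw [if_pos h1, if_neg h2, G.adj_comm, (hsv _ h1).2]
      split_ifs <;> omega
    · rw [if_neg h1, if_pos h2, (hsv _ h2).2]
      split_ifs <;> omega
    · rw [if_neg h1, if_neg h2]
      have := G.loopless.irrefl s
      simp only [this, false_iff]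
      split_ifs <;> omega

/-! ### Cuts, and the barrier in a chordal graph -/

/-- The vertices `s` and `t` cannot be separated by `k` other vertices. -/
def NoCut (G : SimpleGraph V) (k : ℕ) (s t : V) : Prop :=
  ∀ S : Finset V, s ∉ S → t ∉ S → S.card ≤ k → (G.avoid S).Reachable s t

theorem NoCut.of_adj {G : SimpleGraph V} {k : ℕ} {s t : V} (h : G.Adj s t) : G.NoCut k s t :=
  fun _ hs ht _ => Adj.reachable ⟨h, hs, ht⟩

theorem NoCut.refl {G : SimpleGraph V} {k : ℕ} {s : V} : G.NoCut k s s :=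
  fun _ _ _ _ => Reachable.refl _

/-- The vertices that can be reached from `t` outside of the closed neighbourhood of `s`. -/
def farSide (G : SimpleGraph V) (s t : V) : Set V :=
  {x | (G.avoid {y | y = s ∨ G.Adj s y}).Reachable t x}

/-- The neighbours of `s` with a neighbour in `G.farSide s t`. -/
def barrier (G : SimpleGraph V) (s t : V) : Set V :=
  {v | G.Adj s v ∧ ∃ y ∈ G.farSide s t, G.Adj v y}

variable {G : SimpleGraph V} {s t : V} {k : ℕ}

theorem self_mem_farSide : t ∈ G.farSide s t := Reachable.refl t

theorem not_adj_of_mem_farSide (hst : s ≠ t) (hadj : ¬ G.Adj s t) {x : V}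
    (hx : x ∈ G.farSide s t) : x ≠ s ∧ ¬ G.Adj s x := by
  have := hx.notMem_of_avoid (by simp [hst.symm, hadj])
  simpa [not_or] using this

theorem mem_farSide_of_adj (hst : s ≠ t) (hadj : ¬ G.Adj s t) {x y : V} (hx : x ∈ G.farSide s t)
    (hxy : G.Adj x y) (hy : ¬ G.Adj s y) : y ∈ G.farSide s t := by
  have h := not_adj_of_mem_farSide hst hadj hx
  refine Reachable.trans hx (Adj.reachable ⟨hxy, by simpa [not_or] using h, ?_⟩)
  simp only [Set.mem_ofPred_eq, not_or]
  exact ⟨fun e => h.2 (e ▸ hxy.symm), hy⟩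

/-- The far side of `t` can be entered only through the barrier. If `D` contained the barrier, no
path outside `D` would lead from `s` into the far side. -/
theorem NoCut.exists_barrier (h : G.NoCut k s t) (hst : s ≠ t) (hadj : ¬ G.Adj s t) {D : Finset V}
    (hs : s ∉ D) (ht : t ∉ D) (hD : D.card ≤ k) : ∃ v ∈ G.barrier s t, v ∉ D := by
  by_contra! hB
  have hsC : s ∉ G.farSide s t := fun e => (not_adj_of_mem_farSide hst hadj e).1 rfl
  refine ((h D hs ht hD).of_closed (P := fun x => x ∉ G.farSide s t) hsC ?_) self_mem_farSide
  intro x y hxy hx hy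
  by_cases hsx : G.Adj s x
  · exact hxy.2.1 (hB x ⟨hsx, y, hy, hxy.1⟩)
  · exact hx (mem_farSide_of_adj hst hadj hy hxy.1.symm hsx)

/-- Two barrier vertices are joined through the far side, which contains no neighbour of `s`. -/
theorem Chordal.barrier_clique (hG : G.Chordal) (hst : s ≠ t) (hadj : ¬ G.Adj s t) {v w : V}
    (hv : v ∈ G.barrier s t) (hw : w ∈ G.barrier s t) (hvw : v ≠ w) : G.Adj v w := by
  obtain ⟨hsv, y, hy, hvy⟩ := hv
  obtain ⟨hsw, z, hz, hwz⟩ := hw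
  refine hG.adj_of_reachable (C := G.farSide s t)
    (fun x hx => not_adj_of_mem_farSide hst hadj hx) hsv hsw hvw ?_
  have key : ∀ x ∈ G.farSide s t, (G.avoid (G.farSide s t ∪ {v, w})ᶜ).Reachable t x := by
    intro x hx
    refine (Reachable.of_closed hx (P := fun x => x ∈ G.farSide s t ∧
      (G.avoid (G.farSide s t ∪ {v, w})ᶜ).Reachable t x) ⟨self_mem_farSide, Reachable.refl t⟩ ?_).2
    rintro a b hab ⟨ha, hr⟩
    have hb := mem_farSide_of_adj hst hadj ha hab.1 fun e => hab.2.2 (.inr e)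
    exact ⟨hb, hr.trans (Adj.reachable ⟨hab.1, by simp [ha], by simp [hb]⟩)⟩
  have h1 : (G.avoid (G.farSide s t ∪ {v, w})ᶜ).Adj v y := ⟨hvy, by simp, by simp [hy]⟩
  have h2 : (G.avoid (G.farSide s t ∪ {v, w})ᶜ).Adj z w := ⟨hwz.symm, by simp [hz], by simp⟩
  exact h1.reachable.trans ((key y hy).symm.trans ((key z hz).trans h2.reachable))

/-- A path from `t` to `s` outside the cut stays in the far side until it meets the barrier, in some
`w`; the clique joins `v` to `w`. -/
theorem Chordal.noCut_of_barrier [DecidableEq V] (hG : G.Chordal) (h : G.NoCut k s t) (hst : s ≠ t)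
    (hadj : ¬ G.Adj s t) {v : V} (hv : v ∈ G.barrier s t) : G.NoCut k v t := by
  intro S hvS htS hS
  -- Now `S` may contain `s`. Erasing it is harmless, since far side vertices are not adjacent to
  -- `s` and the barrier is met first.
  have hr := (h (S.erase s) (by simp) (by simp [htS]) ((Finset.card_erase_le).trans hS)).symm
  have key := hr.of_closed (P := fun x => (x ∈ G.farSide s t ∧ (G.avoid S).Reachable x t) ∨
    ∃ w ∈ G.barrier s t, w ∉ S ∧ (G.avoid S).Reachable w t)
    (.inl ⟨self_mem_farSide, Reachable.refl t⟩) ?_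
  · rcases key with ⟨h1, -⟩ | ⟨w, hw, hwS, hwt⟩
    · exact absurd rfl (not_adj_of_mem_farSide hst hadj h1).1
    · by_cases e : v = w
      · rwa [e]
      · exact (Adj.reachable (⟨hG.barrier_clique hst hadj hv hw e, hvS, hwS⟩ :
          (G.avoid S).Adj v w)).trans hwt
  · rintro x y hxy (⟨hx, hxt⟩ | hw)
    · have hxs := not_adj_of_mem_farSide hst hadj hx
      have hys : y ≠ s := fun e => hxs.2 (e ▸ hxy.1.symm)
      have hxS : x ∉ S := fun e => hxy.2.1 (by simp [e, hxs.1])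
      have hyS : y ∉ S := fun e => hxy.2.2 (by simp [e, hys])
      have hyt : (G.avoid S).Reachable y t :=
        (Adj.reachable (⟨hxy.1.symm, hyS, hxS⟩ : (G.avoid S).Adj y x)).trans hxt
      by_cases hsy : G.Adj s y
      · exact .inr ⟨y, ⟨hsy, x, hx, hxy.1.symm⟩, hyS, hyt⟩
      · exact .inl ⟨mem_farSide_of_adj hst hadj hx hxy.1 hsy, hyt⟩
    · exact .inr hw

/-- The closed neighbourhood of `v` contains the whole barrier, so the new far side cannot leave the
old one; it loses the neighbours of `v` there. -/
theorem Chordal.farSide_ssubset (hG : G.Chordal) (hst : s ≠ t) (hadj : ¬ G.Adj s t) {v : V}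
    (hv : v ∈ G.barrier s t) (hvt : v ≠ t) (hvadj : ¬ G.Adj v t) :
    G.farSide v t ⊂ G.farSide s t := by
  refine ⟨fun x hx => Reachable.of_closed hx (P := (· ∈ G.farSide s t)) self_mem_farSide ?_, ?_⟩
  · intro a b hab ha
    refine mem_farSide_of_adj hst hadj ha hab.1 fun hsb => hab.2.2 ?_
    by_cases e : b = v
    · exact .inl e
    · exact .inr (hG.barrier_clique hst hadj hv ⟨hsb, a, ha, hab.1.symm⟩ (Ne.symm e))
  · obtain ⟨-, y, hy, hvy⟩ := hv
    exact fun hsub => (not_adj_of_mem_farSide hvt hvadj (hsub hy)).2 hvy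

end SimpleGraph

/-! ### Strategies of the two players -/

namespace Rendezvous

variable {V : Type*} {G : SimpleGraph V} {s t : V} {k : ℕ}

theorem mem_pair {x a b : V} : x ∈ pair a b ↔ x = a ∨ x = b := by
  simp [pair]

theorem meet_pair {a b : V} : Meet (pair a b) ↔ a = b := by
  constructor
  · rintro ⟨x, hx⟩
    have ha : a ∈ pair x x := hx ▸ mem_pair.2 (.inl rfl)
    have hb : b ∈ pair x x := hx ▸ mem_pair.2 (.inr rfl)
    simp only [mem_pair, or_self] at ha hb
    rw [ha, hb]
  · rintro rfl
    exact ⟨a, rfl⟩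

theorem adjacent_refl {m : ℕ} (X : Sym V m) : Adjacent G X X :=
  Multiset.rel_refl_of_refl_on fun _ _ => .inl rfl

theorem adjacent_pair {a b a' b' : V} (ha : a = a' ∨ G.Adj a a') (hb : b = b' ∨ G.Adj b b') :
    Adjacent G (pair a b) (pair a' b') :=
  Multiset.Rel.cons (r := fun x y => x = y ∨ G.Adj x y) ha (.cons hb .zero)

theorem exists_of_adjacent_pair {a b : V} {F : Sym V 2} (h : Adjacent G (pair a b) F) :
    ∃ a' b', F = pair a' b' ∧ (a = a' ∨ G.Adj a a') ∧ (b = b' ∨ G.Adj b b') := by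
  obtain ⟨F, hF⟩ := F
  have h' : Multiset.Rel (fun x y => x = y ∨ G.Adj x y) (a ::ₘ b ::ₘ 0) F := h
  obtain ⟨a', F', ha, h1, e1⟩ := Multiset.rel_cons_left.1 h'
  obtain ⟨b', F'', hb, h2, e2⟩ := Multiset.rel_cons_left.1 h1
  rw [Multiset.rel_zero_left] at h2
  refine ⟨a', b', ?_, ha, hb⟩
  subst e1 e2 h2
  rfl

theorem compatible_pair {a b : V} {D : Sym V k} :
    Compatible (pair a b) D ↔ a ∉ D ∧ b ∉ D := by
  simp [Compatible, mem_pair]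

theorem compatible_play (f : FacilitatorStrategy G k) (d : DividerStrategy G s t k) (i : ℕ) :
    Compatible (play f d i).1 (play f d i).2 := by
  induction i with
  | zero => exact d.init_compatible
  | succ i ih => exact d.compatible _ _ (f.compatible _ _ ih)

/-- If Facilitator can decrease the rank of his placement whatever Divider's placement is, then he
wins. -/
theorem facilitatorWins_of_rank (W : ℕ → Sym V 2 → Prop)
    (hW : ∀ n F, W n F → ¬ Meet F → ∀ D : Sym V k, Compatible F D →
      ∃ F', Adjacent G F F' ∧ Compatible F' D ∧ ∃ m < n, W m F')
    {n : ℕ} (hst : W n (pair s t)) : FacilitatorWins G s t k := by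
  classical
  have key : ∀ (F : Sym V 2) (D : Sym V k), ∃ F', Compatible F D → Adjacent G F F' ∧
      Compatible F' D ∧ (¬ Meet F → ∀ n, W n F → ∃ m < n, W m F') := by
    intro F D
    -- A placement may have several ranks. The reply goes below the least one, hence below all of
    -- them, so a single positional strategy suffices.
    by_cases h : Compatible F D ∧ ¬ Meet F ∧ ∃ n, W n F
    · obtain ⟨h1, h2, h3⟩ := h
      obtain ⟨F', h4, h5, m, hm, h6⟩ := hW _ F (Nat.find_spec h3) h2 D h1
      exact ⟨F', fun _ => ⟨h4, h5, fun _ n hn => ⟨m, hm.trans_le (Nat.find_min' h3 hn), h6⟩⟩⟩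
    · exact ⟨F, fun hc => ⟨adjacent_refl F, hc, fun h1 n hn => absurd ⟨hc, h1, n, hn⟩ h⟩⟩
  choose mv hmv using key
  let f : FacilitatorStrategy G k :=
    ⟨mv, fun F D h => (hmv F D h).1, fun F D h => (hmv F D h).2.1⟩
  refine ⟨f, fun d => ?_⟩
  suffices ∀ n i, W n (play f d i).1 → ∃ j, Meet (play f d j).1 from this n 0 hst
  intro n
  induction n using Nat.strong_induction_on with
  | _ n ih =>
    intro i hi
    by_cases hm : Meet (play f d i).1
    · exact ⟨i, hm⟩
    · obtain ⟨m, hmn, h⟩ := (hmv _ _ (compatible_play f d i)).2.2 hm n hi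
      exact ih m hmn (i + 1) h

/-- With Divider standing on the cut forever, each agent of Facilitator stays in the component in
which it started. -/
theorem FacilitatorWins.noCut (hG : G.Connected) (h : FacilitatorWins G s t k) :
    G.NoCut k s t := by
  classical
  obtain ⟨f, hf⟩ := h
  intro S hs ht hS
  by_contra hr
  -- The empty set is no cut of a connected graph, so there is a vertex on which to put the surplus
  -- agents.
  have hne : S.Nonempty := by
    rw [Finset.nonempty_iff_ne_empty]
    rintro rfl
    refine hr ((hG.preconnected s t).of_closed SimpleGraph.Reachable.rfl fun a b hab ha => ?_)
    exact ha.trans (SimpleGraph.Adj.reachable ⟨hab, by simp, by simp⟩)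
  obtain ⟨x, hx⟩ := hne
  let D : Sym V k := ⟨S.val + Multiset.replicate (k - S.card) x, by simp; omega⟩
  have hD : ∀ v, v ∈ D ↔ v ∈ S := by
    intro v
    rw [← Sym.mem_coe]
    simp only [D, Sym.coe_mk, Multiset.mem_add, Finset.mem_val, Multiset.mem_replicate]
    exact ⟨fun e => e.elim id fun e => e.2 ▸ hx, .inl⟩
  let d : DividerStrategy G s t k :=
    { init := D
      init_compatible := compatible_pair.2 ⟨by rwa [hD], by rwa [hD]⟩
      move := fun _ D => D
      adjacent := fun _ D _ => adjacent_refl D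
      compatible := fun _ _ h => h }
  have hplay : ∀ i, (play f d i).2 = D := by
    intro i
    induction i with
    | zero => rfl
    | succ i ih => exact ih
  have inv : ∀ i, ∃ a b, (play f d i).1 = pair a b ∧ (G.avoid S).Reachable s a ∧
      (G.avoid S).Reachable t b := by
    intro i
    induction i with
    | zero => exact ⟨s, t, rfl, SimpleGraph.Reachable.rfl, SimpleGraph.Reachable.rfl⟩
    | succ i ih =>
      obtain ⟨a, b, hab, ha, hb⟩ := ih
      have hadj : Adjacent G (play f d i).1 (play f d (i + 1)).1 :=
        f.adjacent _ _ (compatible_play f d i)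
      have hcomp : Compatible (play f d (i + 1)).1 (play f d (i + 1)).2 :=
        compatible_play f d (i + 1)
      rw [hab] at hadj
      obtain ⟨a', b', e, ha', hb'⟩ := exists_of_adjacent_pair hadj
      rw [e, hplay, compatible_pair, hD, hD] at hcomp
      have step : ∀ {u v w : V}, u ∉ S → (G.avoid S).Reachable u v → w ∉ S → v = w ∨ G.Adj v w →
          (G.avoid S).Reachable u w := by
        rintro u v w hu huv hw (rfl | hvw)
        · exact huv
        · exact huv.trans (SimpleGraph.Adj.reachable ⟨hvw, huv.notMem_of_avoid hu, hw⟩)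
      exact ⟨a', b', e, step hs ha hcomp.1 ha', step ht hb hcomp.2 hb'⟩
  obtain ⟨i, hi⟩ := hf d
  obtain ⟨a, b, e, ha, hb⟩ := inv i
  rw [e, meet_pair] at hi
  exact hr (ha.trans (hi ▸ hb.symm))

theorem card_toFinset_le [DecidableEq V] (D : Sym V k) : (D : Multiset V).toFinset.card ≤ k :=
  (Multiset.toFinset_card_le _).trans_eq D.2

/-- Ranks: 0 for a meeting, 1 for adjacent agents, 2 for inseparable ones. -/
theorem facilitatorWins_of_P5Free (hG : G.P5Free) (h : G.NoCut k s t) :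
    FacilitatorWins G s t k := by
  classical
  refine facilitatorWins_of_rank (n := 2) (fun n F => ∃ a b, F = pair a b ∧
    (a = b ∨ (G.Adj a b ∧ 1 ≤ n) ∨ (G.NoCut k a b ∧ 2 ≤ n))) ?_
    ⟨s, t, rfl, .inr (.inr ⟨h, le_rfl⟩)⟩
  rintro n _ ⟨a, b, rfl, hab⟩ hm D hD
  rw [meet_pair] at hm
  rw [compatible_pair] at hD
  have meet : ∀ x, a = x ∨ G.Adj a x → b = x ∨ G.Adj b x → x ∉ D → 1 ≤ n →
      ∃ F', Adjacent G (pair a b) F' ∧ Compatible F' D ∧ ∃ m < n, ∃ a b, F' = pair a b ∧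
        (a = b ∨ (G.Adj a b ∧ 1 ≤ m) ∨ (G.NoCut k a b ∧ 2 ≤ m)) := fun x hax hbx hx hn =>
    ⟨pair x x, adjacent_pair hax hbx, compatible_pair.2 ⟨hx, hx⟩, 0, hn, x, x, rfl, .inl rfl⟩
  rcases hab with hab | ⟨hab, hn⟩ | ⟨hab, hn⟩
  · exact absurd hab hm
  · exact meet b (.inr hab) (.inl rfl) hD.2 hn
  · have hDm : ∀ x, x ∈ (D : Multiset V).toFinset ↔ x ∈ D := fun x => by
      rw [Multiset.mem_toFinset, Sym.mem_coe]
    have hr := hab (D : Multiset V).toFinset (by rw [hDm]; exact hD.1) (by rw [hDm]; exact hD.2)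
      (card_toFinset_le D)
    set S : Set V := ↑((D : Multiset V).toFinset)
    have hSm : ∀ x, x ∈ S ↔ x ∈ D := hDm
    have haS : a ∉ S := by rw [hSm]; exact hD.1
    have h3 := hr.dist_le_three_of_P5Free hG haS
    obtain ⟨v, v0, vl, hadj, hvr, -⟩ := hr.exists_geodesic
    have hvD : ∀ i, v i ∉ D := fun i => by
      rw [← hSm]
      exact (hvr i).notMem_of_avoid haS
    generalize (G.avoid S).dist a b = l at h3 vl hadj
    interval_cases l
    · exact absurd (v0.symm.trans vl) hm
    · exact meet b (.inr (by simpa [v0, vl] using (hadj 0 (by omega)).1)) (.inl rfl) hD.2 (by omega)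
    · refine meet (v 1) (.inr ?_) (.inr ?_) (hvD 1) (by omega)
      · simpa [v0] using (hadj 0 (by omega)).1
      · simpa [vl] using (hadj 1 (by omega)).1.symm
    -- On a path of length 3 both agents move inwards, to the ends of the middle edge.
    · refine ⟨pair (v 1) (v 2), adjacent_pair (.inr ?_) (.inr ?_),
        compatible_pair.2 ⟨hvD 1, hvD 2⟩, 1, by omega, v 1, v 2, rfl,
        .inr (.inl ⟨(hadj 1 (by omega)).1, le_rfl⟩)⟩
      · simpa [v0] using (hadj 0 (by omega)).1
      · simpa [vl] using (hadj 2 (by omega)).1.symm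

/-- The rank is the size of the far side plus 2, which leaves 1 for adjacent agents and 0 for a
meeting. Only the first agent pursues; the second waits. -/
theorem facilitatorWins_of_chordal [Finite V] (hG : G.Chordal) (h : G.NoCut k s t) :
    FacilitatorWins G s t k := by
  classical
  refine facilitatorWins_of_rank (n := (G.farSide s t).ncard + 2) (fun n F => ∃ a b, F = pair a b ∧
    (a = b ∨ (G.Adj a b ∧ 1 ≤ n) ∨ (G.NoCut k a b ∧ (G.farSide a b).ncard + 2 ≤ n))) ?_
    ⟨s, t, rfl, .inr (.inr ⟨h, le_rfl⟩)⟩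
  rintro n _ ⟨a, b, rfl, hab⟩ hm D hD
  rw [meet_pair] at hm
  rw [compatible_pair] at hD
  by_cases hadj : G.Adj a b
  · refine ⟨pair b b, adjacent_pair (.inr hadj) (.inl rfl), compatible_pair.2 ⟨hD.2, hD.2⟩, 0, ?_,
      b, b, rfl, .inl rfl⟩
    rcases hab with hab | hab | hab
    · exact absurd hab hm
    · omega
    · omega
  · obtain ⟨hab, hn⟩ : G.NoCut k a b ∧ (G.farSide a b).ncard + 2 ≤ n := by simpa [hm, hadj] using hab
    have hDm : ∀ x, x ∈ (D : Multiset V).toFinset ↔ x ∈ D := fun x => by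
      rw [Multiset.mem_toFinset, Sym.mem_coe]
    obtain ⟨v, hv, hvD⟩ := hab.exists_barrier hm hadj (D := (D : Multiset V).toFinset)
      (by rw [hDm]; exact hD.1) (by rw [hDm]; exact hD.2) (card_toFinset_le D)
    rw [hDm] at hvD
    refine ⟨pair v b, adjacent_pair (.inr hv.1) (.inl rfl), compatible_pair.2 ⟨hvD, hD.2⟩, n - 1,
      by omega, v, b, rfl, ?_⟩
    by_cases hvb : v = b
    · exact .inl hvb
    by_cases hvadj : G.Adj v b
    · exact .inr (.inl ⟨hvadj, by omega⟩)
    have := Set.ncard_lt_ncard (hG.farSide_ssubset hm hadj hv hvb hvadj)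
    exact .inr (.inr ⟨hG.noCut_of_barrier hab hm hadj hv, by omega⟩)

end Rendezvous

/-! ### Disjoint paths by an auction -/

namespace SimpleGraph

variable {V : Type*} [Fintype V] [DecidableEq V]

/-- The state of an auction that computes a largest family of disjoint paths from `s` to `t`. Every
vertex `v` has an owner `m v`, itself or a neighbour, and a price `p v`. Only `s` owns several
vertices. The vertex `u` bids next; `c` vertices have been dispatched to `t`. -/
structure Auction (G : SimpleGraph V) (s t : V) (m : V → V) (p : V → ℕ) (u : V) (c : ℕ) :
    Prop where
  price_source : p s = Fintype.card V
  price_sink : p t = 0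
  owner_source : m s = s
  owner_near : ∀ v, m v = v ∨ G.Adj (m v) v
  owner_ne_sink : ∀ v, v ≠ t → m v ≠ t
  -- Complementary slackness up to one: the owner bought at the lowest price and then raised it by
  -- one.
  slack : ∀ v, v ≠ s → ∀ w, w = m v ∨ G.Adj (m v) w → p v ≤ p w + 1
  inj : ∀ v w, m v = m w → v = w ∨ m v = s
  bidder_ne_sink : u ≠ t
  bidder_free : u ≠ s → ∀ v, m v ≠ u
  -- The constant 1 counts `s`, which owns itself; the last term counts the path under construction.
  count : (Finset.univ.filter fun v => m v = s).card = c + 1 + if u = s then 0 else 1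
  -- The exception is for the last vertices of completed paths, which may own nothing.
  covered : ∀ w, w ≠ u → (∃ v, m v = w) ∨ G.Adj w t
  price_le : ∀ v, p v ≤ Fintype.card V

namespace Auction

variable {G : SimpleGraph V} {s t : V} {m : V → V} {p : V → ℕ} {u : V} {c k : ℕ}

/-- The price `n` keeps `s` from ever being sold, since bids are made only below `n`. -/
theorem init (hst : s ≠ t) :
    G.Auction s t (fun v => v) (Function.update (fun _ => 0) s (Fintype.card V)) s 0 where
  price_source := by simp
  price_sink := by simp [hst.symm]
  owner_source := rfl
  owner_near _ := .inl rfl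
  owner_ne_sink _ h := h
  slack v hv w _ := by simp [hv]
  inj _ _ h := .inl h
  bidder_ne_sink := hst
  bidder_free h := absurd rfl h
  count := by simp [Finset.filter_eq']
  covered w _ := .inl ⟨w, rfl⟩
  price_le v := by
    by_cases h : v = s
    · simp [h]
    · simp [h]

/-- Only the price of `b` changes, and it rises, so the other slack inequalities persist; minimality
of `p b` gives the one for `b`. -/
theorem bid (h : G.Auction s t m p u c) {b : V} (hb : b = u ∨ G.Adj u b) (hbt : b ≠ t)
    (hmin : ∀ w, w = u ∨ G.Adj u w → p b ≤ p w) (hlt : p b < Fintype.card V) :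
    G.Auction s t (Function.update m b u) (Function.update p b (p b + 1)) (m b) c := by
  have hbs : b ≠ s := fun e => by rw [e, h.price_source] at hlt; exact lt_irrefl _ hlt
  have hp : ∀ w, p w ≤ Function.update p b (p b + 1) w := by
    intro w
    by_cases e : w = b
    · subst e; simp
    · simp [e]
  refine ⟨?_, ?_, ?_, ?_, ?_, ?_, ?_, h.owner_ne_sink b hbt, ?_, ?_, ?_, ?_⟩
  · rw [Function.update_of_ne hbs.symm, h.price_source]
  · rw [Function.update_of_ne hbt.symm, h.price_sink]
  · rw [Function.update_of_ne hbs.symm, h.owner_source]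
  · intro v
    by_cases e : v = b
    · subst e; simpa [eq_comm] using hb
    · simpa [e] using h.owner_near v
  · intro v hv
    by_cases e : v = b
    · subst e; simpa using h.bidder_ne_sink
    · simpa [e] using h.owner_ne_sink v hv
  · intro v hv w hw
    by_cases e : v = b
    · subst e
      rw [Function.update_self] at hw ⊢
      exact Nat.succ_le_succ ((hmin w hw).trans (hp w))
    · rw [Function.update_of_ne e] at hw ⊢
      exact (h.slack v hv w hw).trans (Nat.succ_le_succ (hp w))
  · intro v w hvw
    by_cases e : v = b <;> by_cases e' : w = b
    · exact .inl (e.trans e'.symm)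
    · subst e
      rw [Function.update_self] at hvw ⊢
      rw [Function.update_of_ne e'] at hvw
      by_contra! hne
      exact h.bidder_free hne.2 w hvw.symm
    · subst e'
      rw [Function.update_self, Function.update_of_ne e] at hvw
      rw [Function.update_of_ne e, hvw]
      by_contra! hne
      exact h.bidder_free hne.2 v hvw
    · rw [Function.update_of_ne e, Function.update_of_ne e'] at hvw
      rw [Function.update_of_ne e]
      exact h.inj v w hvw
  · intro hms v
    by_cases e : v = b
    · subst e
      rw [Function.update_self]
      intro hum
      exact h.bidder_free (hum ▸ hms) v hum.symm
    · rw [Function.update_of_ne e]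
      intro hvb
      exact (h.inj v b hvb).elim e fun e' => hms (hvb ▸ e')
  · have hc := h.count
    have h1 : ∀ f : V → V, (Finset.univ.filter fun v => f v = s).card =
        ((Finset.univ.erase b).filter fun v => f v = s).card + if f b = s then 1 else 0 := by
      intro f
      rw [← Finset.insert_erase (Finset.mem_univ b), Finset.filter_insert, Finset.erase_insert_eq_erase]
      split_ifs
      · rw [Finset.card_insert_of_notMem (by simp)]; simp
      · simp
    rw [h1] at hc ⊢
    have h2 : ((Finset.univ.erase b).filter fun v => Function.update m b u v = s) =
        (Finset.univ.erase b).filter fun v => m v = s := by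
      apply Finset.filter_congr
      intro v hv
      rw [Function.update_of_ne (Finset.ne_of_mem_erase hv)]
    rw [h2, Function.update_self]
    split_ifs at hc ⊢ <;> omega
  · intro w hw
    by_cases e : w = u
    · exact .inl ⟨b, by simp [e]⟩
    · refine (h.covered w e).imp_left ?_
      rintro ⟨v, hv⟩
      refine ⟨v, ?_⟩
      rw [Function.update_of_ne, hv]
      rintro rfl
      exact hw hv.symm
  · intro v
    by_cases e : v = b
    · subst e; simpa using hlt
    · simpa [e] using h.price_le v

theorem deposit (h : G.Auction s t m p u c) (hst : s ≠ t) (hus : u ≠ s) (hut : G.Adj u t) :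
    G.Auction s t m p s (c + 1) :=
  { h with
    bidder_ne_sink := hst
    bidder_free := fun e => absurd rfl e
    count := by rw [h.count, if_neg hus, if_pos rfl]
    covered := fun w _ => by
      by_cases e : w = u
      · exact .inr (e ▸ hut)
      · exact h.covered w e }

/-- Let `X` be the side of `s` of a cut `S`. Then `s` owns `c + 1` vertices, and each other vertex
of `X` owns one, not being adjacent to `t`. All of these lie in `X ∪ S`, so `S` has at least `c`
elements. -/
theorem noCut (h : G.Auction s t m p s c) (hck : k < c) : G.NoCut k s t := by
  classical
  intro S hs ht hS
  by_contra hr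
  let X : Finset V := Finset.univ.filter fun x => (G.avoid S).Reachable s x
  have hX : ∀ x, x ∈ X ↔ (G.avoid S).Reachable s x := fun x => by simp [X]
  have hXS : ∀ x ∈ X, x ∉ S := fun x hx => ((hX x).1 hx).notMem_of_avoid hs
  have hsX : s ∈ X := (hX s).2 Reachable.rfl
  have hnear : ∀ x ∈ X, ∀ y, G.Adj x y → y ∈ X ∪ S := by
    intro x hx y hxy
    by_cases hy : y ∈ S
    · exact Finset.mem_union_right _ hy
    · exact Finset.mem_union_left _
        ((hX y).2 (((hX x).1 hx).trans (Adj.reachable ⟨hxy, hXS x hx, hy⟩)))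
  have howner : ∀ v, m v ∈ X → v ∈ X ∪ S := by
    intro v hv
    rcases h.owner_near v with e | e
    · exact Finset.mem_union_left _ (e ▸ hv)
    · exact hnear _ hv v e
  have h1 : c + 1 ≤ ((X ∪ S).filter fun v => m v = s).card := by
    have := h.count
    rw [if_pos rfl] at this
    rw [← this]
    refine Finset.card_le_card fun v hv => ?_
    have hv : m v = s := by simpa using hv
    exact Finset.mem_filter.2 ⟨howner v (hv ▸ hsX), hv⟩
  have h2 : X.card - 1 ≤ ((X ∪ S).filter fun v => ¬ m v = s).card := by
    rw [← Finset.card_erase_of_mem hsX]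
    refine le_trans (Finset.card_le_card ?_) (Finset.card_image_le (f := m))
    intro x hx
    obtain ⟨hxs, hx⟩ := Finset.mem_erase.1 hx
    rcases h.covered x hxs with ⟨v, rfl⟩ | hxt
    · exact Finset.mem_image.2 ⟨v, Finset.mem_filter.2 ⟨howner v hx, hxs⟩, rfl⟩
    · exact absurd (((hX x).1 hx).trans (Adj.reachable ⟨hxt, hXS x hx, ht⟩)) hr
  have h3 := Finset.card_filter_add_card_filter_not (s := X ∪ S) (fun v => m v = s)
  have h4 := Finset.card_union_le X S
  have h5 := Finset.card_pos.2 ⟨s, hsX⟩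
  omega

/-- Let `R` consist of the vertices priced above a gap `j`, and `L` of the bidder and the owners of
`R \ {s}`. By slackness the closed neighbourhood of `L` lies in `R`, so `R \ L` is a cut; as only
`s` owns several vertices, its size is at most `c`. -/
theorem not_noCut (h : G.Auction s t m p u c) (hst : s ≠ t) (hck : c ≤ k)
    (hu : ∀ w, w = u ∨ G.Adj u w → Fintype.card V ≤ p w) : ¬ G.NoCut k s t := by
  classical
  -- The `n - 2` vertices other than `s` and `t` cannot take all the prices `1, ..., n - 1`.
  obtain ⟨j, hj1, hjn, hj⟩ : ∃ j, 1 ≤ j ∧ j < Fintype.card V ∧ ∀ v, p v ≠ j := by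
    have hlt : (((Finset.univ.erase s).erase t).image p).card <
        (Finset.Ico 1 (Fintype.card V)).card := by
      refine Finset.card_image_le.trans_lt ?_
      rw [Finset.card_erase_of_mem (by simp [hst.symm]), Finset.card_erase_of_mem (by simp),
        Nat.card_Ico, Finset.card_univ]
      have := Fintype.one_lt_card_iff.2 ⟨s, t, hst⟩
      omega
    obtain ⟨j, hj, hj'⟩ := Finset.exists_mem_notMem_of_card_lt_card hlt
    rw [Finset.mem_Ico] at hj
    refine ⟨j, hj.1, hj.2, fun v hv => ?_⟩
    by_cases hvs : v = s
    · rw [hvs, h.price_source] at hv; omega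
    by_cases hvt : v = t
    · rw [hvt, h.price_sink] at hv; omega
    exact hj' (Finset.mem_image.2 ⟨v, by simp [hvs, hvt], hv⟩)
  let R : Finset V := Finset.univ.filter fun v => j < p v
  have hR : ∀ v, v ∈ R ↔ j < p v := fun v => by simp [R]
  let L : Finset V := insert u ((R.erase s).image m)
  have hnear : ∀ x ∈ L, ∀ y, y = x ∨ G.Adj x y → y ∈ R := by
    intro x hx y hy
    rw [hR]
    rcases Finset.mem_insert.1 hx with rfl | hx
    · exact hjn.trans_le (hu y hy)
    · obtain ⟨v, hv, rfl⟩ := Finset.mem_image.1 hx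
      obtain ⟨hvs, hv⟩ := Finset.mem_erase.1 hv
      have h1 := h.slack v hvs y hy
      have h2 := (hR v).1 hv
      have h3 := hj y
      omega
  have hLR : L ⊆ R := fun x hx => hnear x hx x (.inl rfl)
  -- Otherwise the owners of `R \ {s}` are distinct and differ from `u`, so `L` has one element more
  -- than `R \ {s}`, which contains it.
  have hsL : s ∈ L := by
    by_contra hs
    have hus : u ≠ s := fun e => hs (e ▸ Finset.mem_insert_self _ _)
    have hle : L.card ≤ (R.erase s).card :=
      Finset.card_le_card fun x hx => Finset.mem_erase.2 ⟨fun e => hs (e ▸ hx), hLR hx⟩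
    rw [Finset.card_insert_of_notMem, Finset.card_image_of_injOn] at hle
    · omega
    · intro v hv w _ hvw
      refine (h.inj v w hvw).resolve_right fun e => hs ?_
      rw [← e]
      exact Finset.mem_insert_of_mem (Finset.mem_image_of_mem _ hv)
    · intro hmem
      obtain ⟨v, -, hv⟩ := Finset.mem_image.1 hmem
      exact h.bidder_free hus v hv
  have htR : t ∉ R := by rw [hR, h.price_sink]; omega
  intro hcut
  have hreach := hcut (R \ L) (by simp [hsL]) (by simp [htR]) ?_
  · refine htR (hLR (hreach.of_closed (P := (· ∈ L)) hsL fun a b hab ha => ?_))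
    have hb := hab.2.2
    have hbR := hnear a ha b (.inr hab.1)
    by_contra hbL
    exact hb (by simp [hbR, hbL])
  · refine le_trans ?_ hck
    have h1 : (R.filter fun v => m v = s).card ≤ c + 1 + if u = s then 0 else 1 := by
      rw [← h.count]
      exact Finset.card_le_card (Finset.filter_subset_filter _ (Finset.subset_univ _))
    have h2 : (R.filter fun v => ¬ m v = s).card ≤ ((L.erase s).erase u).card := by
      refine Finset.card_le_card_of_injOn m ?_ ?_
      · intro v hv
        obtain ⟨hv, hvs⟩ := Finset.mem_filter.1 hv
        have hv' : v ≠ s := fun e => hvs (by rw [e, h.owner_source])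
        refine Finset.mem_erase.2 ⟨?_, Finset.mem_erase.2 ⟨hvs, Finset.mem_insert_of_mem
          (Finset.mem_image_of_mem _ (Finset.mem_erase.2 ⟨hv', hv⟩))⟩⟩
        by_cases hus : u = s
        · rwa [hus]
        · exact h.bidder_free hus v
      · intro v hv w _ hvw
        exact (h.inj v w hvw).resolve_right (Finset.mem_filter.1 hv).2
    have h3 := Finset.card_filter_add_card_filter_not (s := R) (fun v => m v = s)
    have h4 := Finset.card_sdiff_add_card_eq_card hLR
    have h5 := Finset.card_pos.2 ⟨s, hsL⟩
    have h6 : ((L.erase s).erase u).card + 1 + (if u = s then 0 else 1) = L.card := by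
      by_cases hus : u = s
      · rw [if_pos hus, hus, Finset.erase_eq_of_notMem (by simp), Finset.card_erase_of_mem hsL]
        omega
      · have hu' : u ∈ L.erase s := Finset.mem_erase.2 ⟨hus, Finset.mem_insert_self _ _⟩
        have := Finset.card_pos.2 ⟨u, hu'⟩
        rw [Finset.card_erase_of_mem hu']
        rw [Finset.card_erase_of_mem hsL] at this ⊢
        rw [if_neg hus]
        omega
    omega

end Auction

end SimpleGraph

/-! ### Execution and running time of programs -/

namespace RAM

theorem State.reg_setReg (σ : State) (x a y : ℕ) :
    (σ.setReg x a).reg y = if y = x then a else σ.reg y := by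
  simp [State.setReg, Function.update_apply]

theorem State.mem_setReg (σ : State) (x a : ℕ) : (σ.setReg x a).mem = σ.mem := rfl

theorem State.reg_setMem (σ : State) (i a : ℕ) : (σ.setMem i a).reg = σ.reg := rfl

theorem State.mem_setMem (σ : State) (i a j : ℕ) :
    (σ.setMem i a).mem j = if j = i then a else σ.mem j := by
  simp [State.setMem, Function.update_apply]

namespace Prog

/-- Programs without loops. -/
def LoopFree : Prog → Prop
  | seq p q => p.LoopFree ∧ q.LoopFree
  | ite _ p q => p.LoopFree ∧ q.LoopFree
  | loop _ _ => False
  | _ => True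

/-- The effect of a program without loops. -/
def eval : Prog → State → State
  | skip, σ => σ
  | const x c, σ => σ.setReg x c
  | copy x y, σ => σ.setReg x (σ.reg y)
  | add x y z, σ => σ.setReg x (σ.reg y + σ.reg z)
  | sub x y z, σ => σ.setReg x (σ.reg y - σ.reg z)
  | load x y, σ => σ.setReg x (σ.mem (σ.reg y))
  | store x y, σ => σ.setMem (σ.reg x) (σ.reg y)
  | seq p q, σ => q.eval (p.eval σ)
  | ite x p q, σ => if σ.reg x = 0 then q.eval σ else p.eval σ
  | loop _ _, σ => σ

/-- The program does not write to the register `r`. -/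
def Preserves (r : ℕ) : Prog → Prop
  | const x _ | copy x _ | add x _ _ | sub x _ _ | load x _ => r ≠ x
  | seq p q | ite _ p q => p.Preserves r ∧ q.Preserves r
  | loop _ p => p.Preserves r
  | skip | store _ _ => True

theorem Preserves.reg_eval {r : ℕ} {p : Prog} (h : p.Preserves r) (σ : State) :
    (p.eval σ).reg r = σ.reg r := by
  induction p generalizing σ with
  | seq p q ihp ihq => exact (ihq h.2 _).trans (ihp h.1 σ)
  | ite x p q ihp ihq =>
    rw [eval]
    split_ifs
    exacts [ihq h.2 σ, ihp h.1 σ]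
  | skip | loop | store => rfl
  | const | copy | add | sub | load => simp only [eval, State.reg_setReg]; exact if_neg h

/-- A bound on the number of steps of a program without loops. -/
def cost : Prog → ℕ
  | seq p q => p.cost + q.cost
  | ite _ p q => p.cost + q.cost + 1
  | _ => 1

/-- Execute the programs of a list one after another. -/
def block : List Prog → Prog
  | [] => skip
  | p :: l => seq p (block l)

theorem exists_exec {p : Prog} (hp : p.LoopFree) (σ : State) :
    ∃ T ≤ p.cost, Exec p σ T (p.eval σ) := by
  induction p generalizing σ with
  | seq p q ihp ihq =>
    obtain ⟨T, hT, h⟩ := ihp hp.1 σ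
    obtain ⟨T', hT', h'⟩ := ihq hp.2 (p.eval σ)
    exact ⟨T + T', Nat.add_le_add hT hT', h.seq h'⟩
  | ite x p q ihp ihq =>
    by_cases hx : σ.reg x = 0
    · obtain ⟨T, hT, h⟩ := ihq hp.2 σ
      refine ⟨T + 1, by simp only [cost]; omega, ?_⟩
      rw [eval, if_pos hx]
      exact .ite_false hx h
    · obtain ⟨T, hT, h⟩ := ihp hp.1 σ
      refine ⟨T + 1, by simp only [cost]; omega, ?_⟩
      rw [eval, if_neg hx]
      exact .ite_true hx h
  | loop x p => exact hp.elim
  | skip => exact ⟨1, le_rfl, .skip σ⟩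
  | const x c => exact ⟨1, le_rfl, .const σ x c⟩
  | copy x y => exact ⟨1, le_rfl, .copy σ x y⟩
  | add x y z => exact ⟨1, le_rfl, .add σ x y z⟩
  | sub x y z => exact ⟨1, le_rfl, .sub σ x y z⟩
  | load x y => exact ⟨1, le_rfl, .load σ x y⟩
  | store x y => exact ⟨1, le_rfl, .store σ x y⟩

/-- Started in `σ`, the program halts after at most `K` steps in a state with the property `Q`. -/
def Runs (p : Prog) (σ : State) (K : ℕ) (Q : State → Prop) : Prop :=
  ∃ T ≤ K, ∃ σ', Exec p σ T σ' ∧ Q σ'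

variable {p q : Prog} {σ : State} {K K' x : ℕ} {Q R : State → Prop}

theorem Runs.mono (h : p.Runs σ K Q) (hK : K ≤ K') (hQ : ∀ σ', Q σ' → R σ') : p.Runs σ K' R := by
  obtain ⟨T, hT, σ', h, hq⟩ := h
  exact ⟨T, hT.trans hK, σ', h, hQ σ' hq⟩

theorem Runs.of_loopFree (hp : p.LoopFree) (hK : p.cost ≤ K) (hQ : Q (p.eval σ)) :
    p.Runs σ K Q := by
  obtain ⟨T, hT, h⟩ := exists_exec hp σ
  exact ⟨T, hT.trans hK, _, h, hQ⟩

theorem Runs.seq (hp : p.Runs σ K Q) (hq : ∀ σ', Q σ' → q.Runs σ' K' R) :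
    (Prog.seq p q).Runs σ (K + K') R := by
  obtain ⟨T, hT, σ', h, hσ'⟩ := hp
  obtain ⟨T', hT', σ'', h', hσ''⟩ := hq σ' hσ'
  exact ⟨T + T', Nat.add_le_add hT hT', σ'', h.seq h', hσ''⟩

theorem Runs.ite (hp : σ.reg x ≠ 0 → p.Runs σ K Q) (hq : σ.reg x = 0 → q.Runs σ K Q) :
    (Prog.ite x p q).Runs σ (K + 1) Q := by
  by_cases hx : σ.reg x = 0
  · obtain ⟨T, hT, σ', h, hσ'⟩ := hq hx
    exact ⟨T + 1, by omega, σ', .ite_false hx h, hσ'⟩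
  · obtain ⟨T, hT, σ', h, hσ'⟩ := hp hx
    exact ⟨T + 1, by omega, σ', .ite_true hx h, hσ'⟩

/-- The rule for loops: `I j` is an invariant that decreases the number `j` in every iteration. -/
theorem Runs.loop (I : ℕ → State → Prop)
    (h : ∀ j σ, I j σ → (σ.reg x = 0 ∧ Q σ) ∨
      (σ.reg x ≠ 0 ∧ p.Runs σ K fun σ' => ∃ i < j, I i σ')) (j : ℕ) (hσ : I j σ) :
    (Prog.loop x p).Runs σ (j * (K + 1) + 1) Q := by
  induction j using Nat.strong_induction_on generalizing σ with
  | _ j ih =>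
    rcases h j σ hσ with ⟨hx, hQ⟩ | ⟨hx, T, hT, σ', hp, i, hi, hσ'⟩
    · exact ⟨1, by omega, σ, by constructor; exact hx, hQ⟩
    · obtain ⟨T', hT', σ'', hl, hQ⟩ := ih i hi hσ'
      refine ⟨T + T' + 1, ?_, σ'', .loop_step hx hp hl, hQ⟩
      have : (i + 1) * (K + 1) ≤ j * (K + 1) := Nat.mul_le_mul_right _ hi
      rw [Nat.add_mul] at this
      omega

/-- Add the product of the registers `0` and `y` to the register `x`. -/
def addMul (x y : ℕ) : Prog :=
  .loop y (block [.add x x 0, .const 17 1, .sub y y 17])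

theorem runs_addMul {x y : ℕ} (hx : x ≠ 0) (hy : y ≠ 0) (hxy : x ≠ y) (hx' : x ≠ 17) (hy' : y ≠ 17)
    (σ : State) : (addMul x y).Runs σ (σ.reg y * 5 + 1) fun σ' =>
      σ'.mem = σ.mem ∧ σ'.reg x = σ.reg x + σ.reg y * σ.reg 0 ∧
        ∀ r, r ≠ x → r ≠ y → r ≠ 17 → σ'.reg r = σ.reg r := by
  refine Runs.loop (K := 4) (fun j τ => τ.mem = σ.mem ∧ τ.reg y = j ∧
    τ.reg x + j * σ.reg 0 = σ.reg x + σ.reg y * σ.reg 0 ∧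
    ∀ r, r ≠ x → r ≠ y → r ≠ 17 → τ.reg r = σ.reg r) ?_ _ ⟨rfl, rfl, rfl, fun _ _ _ _ => rfl⟩
  rintro j τ ⟨h1, h2, h3, h4⟩
  rcases j with _ | j
  · exact .inl ⟨h2, h1, by simpa using h3, h4⟩
  · refine .inr ⟨by omega, Runs.of_loopFree (by simp [block, LoopFree]) (by simp [block, cost])
      ⟨j, Nat.lt_succ_self j, ?_⟩⟩
    have h0 := h4 0 hx.symm hy.symm (by decide)
    refine ⟨by simp [block, eval, State.mem_setReg, h1], ?_, ?_, ?_⟩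
    · simp [block, eval, State.reg_setReg, hxy.symm, hy', h2]
    · simp [block, eval, State.reg_setReg, hxy, hx', h0]
      rw [← h3, Nat.add_mul]
      omega
    · intro r hr1 hr2 hr3
      simp [block, eval, State.reg_setReg, hr1, hr2, hr3, h4]

end Prog

end RAM

/-! ### The search for a cheapest vertex, as a program -/

namespace Rendezvous

open RAM RAM.Prog SimpleGraph

/-- The registers and the memory hold the instance and the state of the auction: the owners are in
the cells from `n ^ 2` on, the prices in the cells from `n ^ 2 + n` on. -/
structure Represents {n : ℕ} (G : SimpleGraph (Fin n)) (s t : Fin n) (k : ℕ) (m : Fin n → Fin n)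
    (p : Fin n → ℕ) (u : Fin n) (c : ℕ) (σ : State) : Prop where
  size : σ.reg 0 = n
  source : σ.reg 1 = s
  sink : σ.reg 2 = t
  agents : σ.reg 3 = k
  owners : σ.reg 4 = n * n
  prices : σ.reg 5 = n * n + n
  bidder : σ.reg 6 = u
  counter : σ.reg 7 = c
  adj : ∀ v w : Fin n, (σ.mem (v * n + w) = 0 ↔ ¬ G.Adj v w)
  owner : ∀ v : Fin n, σ.mem (n * n + v) = m v
  price : ∀ v : Fin n, σ.mem (n * n + n + v) = p v

theorem index_lt {n : ℕ} (v w : Fin n) : v.val * n + w.val < n * n := by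
  have h : (v.val + 1) * n ≤ n * n := Nat.mul_le_mul_right n v.isLt
  have := w.isLt
  rw [Nat.add_mul] at h
  omega

/-- Start the search for a cheapest vertex at the bidder. -/
def scanInit : Prog :=
  block [.copy 10 6, .add 16 5 6, .load 11 16, .const 12 0, .copy 13 6, .copy 14 0]

/-- Compare the price of a vertex with the lowest price found so far. -/
def scanBody : Prog :=
  block [.load 15 13, .add 16 5 12, .load 16 16, .sub 18 11 16,
    .ite 15 (.ite 18 (block [.copy 10 12, .copy 11 16]) .skip) .skip,
    .const 17 1, .add 12 12 17, .add 13 13 0, .sub 14 0 12]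

/-- Find a cheapest vertex among the bidder and its neighbours: the register `10` receives the
vertex, the register `11` its price. -/
def scan : Prog :=
  .seq scanInit (.loop 14 scanBody)

theorem runs_scan {n : ℕ} {G : SimpleGraph (Fin n)} {s t : Fin n} {k : ℕ} {m : Fin n → Fin n}
    {p : Fin n → ℕ} {u : Fin n} {c : ℕ} {σ : State} (h : Represents G s t k m p u c σ) :
    scan.Runs σ (n * 20 + 20) fun σ' => σ'.mem = σ.mem ∧ (∀ r < 10, σ'.reg r = σ.reg r) ∧
      ∃ b : Fin n, σ'.reg 10 = b ∧ σ'.reg 11 = p b ∧ (b = u ∨ G.Adj u b) ∧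
        ∀ w, w = u ∨ G.Adj u w → p b ≤ p w := by
  -- Register 13 runs down column `u` of the matrix in steps of `n`, so no product is needed;
  -- register 14 is the loop test.
  let I : ℕ → State → Prop := fun j τ => τ.mem = σ.mem ∧ (∀ r < 10, τ.reg r = σ.reg r) ∧
    ∃ v ≤ n, j = n - v ∧ τ.reg 12 = v ∧ τ.reg 13 = v * n + u ∧ τ.reg 14 = n - v ∧
      ∃ b : Fin n, τ.reg 10 = b ∧ τ.reg 11 = p b ∧ (b = u ∨ G.Adj u b) ∧ p b ≤ p u ∧
        ∀ w : Fin n, w.val < v → G.Adj u w → p b ≤ p w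
  refine Runs.mono (K := 7 + (n * (18 + 1) + 1)) (Runs.seq (Q := I n) (Runs.of_loopFree
    (by simp [scanInit, block, LoopFree]) (by simp [scanInit, block, cost]) ?_)
    fun τ hτ => Runs.loop (K := 18) I ?_ n hτ) (by omega) fun _ h => h
  · refine ⟨rfl, ?_, 0, Nat.zero_le _, rfl, ?_, ?_, ?_, u, ?_, ?_, .inl rfl, le_rfl, by simp⟩
    · exact fun r hr => Preserves.reg_eval (by simp [scanInit, block, Preserves]; omega) σ
    all_goals simp [scanInit, block, eval, State.reg_setReg, State.mem_setReg, h.bidder, h.size,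
      h.prices, h.price]
  · rintro j τ ⟨hmem, hreg, v, hv, rfl, h12, h13, h14, b, h10, h11, hb, hbu, hmin⟩
    rcases hv.eq_or_lt with rfl | hv
    · refine .inl ⟨by simp [h14], hmem, hreg, b, h10, h11, hb, ?_⟩
      rintro w (rfl | hw)
      · exact hbu
      · exact hmin w w.isLt hw
    · refine .inr ⟨by omega, Runs.of_loopFree (by simp [scanBody, block, LoopFree])
        (by simp [scanBody, block, cost]) ⟨n - (v + 1), by omega, ?_⟩⟩
      have ha := h.adj ⟨v, hv⟩ u
      have hp := h.price ⟨v, hv⟩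
      simp only at ha hp
      have h0 := hreg 0 (by decide)
      have h5 := hreg 5 (by decide)
      rw [h.size] at h0
      rw [h.prices] at h5
      have hreg' : ∀ r < 10, (scanBody.eval τ).reg r = σ.reg r := fun r hr =>
        (Preserves.reg_eval (by simp [scanBody, block, Preserves]; omega) τ).trans (hreg r hr)
      by_cases hadj : G.Adj u ⟨v, hv⟩ ∧ p ⟨v, hv⟩ < p b
      · have ha' : σ.mem (v * n + u) ≠ 0 := fun e => ha.1 e hadj.1.symm
        have hlt : ¬ (p b - p ⟨v, hv⟩ = 0) := by omega
        refine ⟨?_, hreg', v + 1, hv, rfl, ?_, ?_, ?_, ⟨v, hv⟩, ?_, ?_, .inr hadj.1, by omega, ?_⟩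
        case refine_7 =>
          intro w hw hw'
          rcases Nat.lt_succ_iff_lt_or_eq.1 hw with e | e
          · exact hadj.2.le.trans (hmin w e hw')
          · rw [show w = ⟨v, hv⟩ from Fin.ext e]
        case refine_3 =>
          simp [scanBody, block, eval, State.reg_setReg, State.mem_setReg, hmem, h13, h12, h5, h11,
            hp, ha', hlt, h0]
          ring
        all_goals simp [scanBody, block, eval, State.reg_setReg, State.mem_setReg, hmem, h13, h12,
            h5, h11, hp, ha', hlt, h0]
      · have hskip : σ.mem (v * n + u) = 0 ∨ p b - p ⟨v, hv⟩ = 0 := by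
          rw [ha, G.adj_comm]
          rw [not_and_or] at hadj
          exact hadj.imp_right fun e => by omega
        refine ⟨?_, hreg', v + 1, hv, rfl, ?_, ?_, ?_, b, ?_, ?_, hb, hbu, ?_⟩
        case refine_7 =>
          intro w hw hw'
          rcases Nat.lt_succ_iff_lt_or_eq.1 hw with e | e
          · exact hmin w e hw'
          · obtain rfl : w = ⟨v, hv⟩ := Fin.ext e
            by_contra! hlt
            exact hadj ⟨hw', hlt⟩
        case refine_3 =>
          rcases hskip with e | e <;>
          · simp [scanBody, block, eval, State.reg_setReg, State.mem_setReg, hmem, h13, h12, h5,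
              h11, hp, e, h0]
            ring
        all_goals
          rcases hskip with e | e <;>
          simp [scanBody, block, eval, State.reg_setReg, State.mem_setReg, hmem, h13, h12, h5,
            h11, hp, e, h0, h10]

end Rendezvous

/-! ### The auction as a program -/

namespace Rendezvous

open RAM RAM.Prog SimpleGraph

variable {n : ℕ} {G : SimpleGraph (Fin n)} {s t : Fin n} {k : ℕ} {m : Fin n → Fin n}
  {p : Fin n → ℕ} {u : Fin n} {c : ℕ} {σ τ : State}

theorem Represents.congr (h : Represents G s t k m p u c σ) (hm : τ.mem = σ.mem)
    (hr : ∀ r < 10, τ.reg r = σ.reg r) : Represents G s t k m p u c τ where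
  size := (hr 0 (by decide)).trans h.size
  source := (hr 1 (by decide)).trans h.source
  sink := (hr 2 (by decide)).trans h.sink
  agents := (hr 3 (by decide)).trans h.agents
  owners := (hr 4 (by decide)).trans h.owners
  prices := (hr 5 (by decide)).trans h.prices
  bidder := (hr 6 (by decide)).trans h.bidder
  counter := (hr 7 (by decide)).trans h.counter
  adj := by rw [hm]; exact h.adj
  owner := by rw [hm]; exact h.owner
  price := by rw [hm]; exact h.price

/-- Give the vertex in the register `10` to the bidder; its former owner bids next. -/
def bid : Prog :=
  block [.add 15 4 10, .load 16 15, .store 15 6, .add 18 5 10, .add 11 11 17, .store 18 11,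
    .copy 6 16]

/-- Dispatch the bidder to `t`, and halt if there are more than `k` paths. -/
def deposit : Prog :=
  block [.add 7 7 17, .copy 6 1, .sub 15 7 3, .ite 15 (block [.const 8 0, .const 9 1]) .skip]

/-- One step of the auction, after a cheapest vertex has been found. -/
def settle : Prog :=
  block [.const 17 1, .sub 15 0 11,
    .ite 15 (block [.sub 15 10 2, .sub 16 2 10, .add 15 15 16, .ite 15 bid deposit])
      (block [.const 8 0, .const 9 0])]

theorem settle_fail (h : Represents G s t k m p u c σ) {b : Fin n} (h11 : σ.reg 11 = p b)
    (hp : n ≤ p b) : (settle.eval σ).reg 8 = 0 ∧ (settle.eval σ).reg 9 = 0 := by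
  have e : n - p b = 0 := by omega
  simp [settle, block, eval, State.reg_setReg, h.size, h11, e]

theorem settle_bid (h : Represents G s t k m p u c σ) {b : Fin n} (h10 : σ.reg 10 = b)
    (h11 : σ.reg 11 = p b) (hp : p b < n) (hbt : b ≠ t) :
    Represents G s t k (Function.update m b u) (Function.update p b (p b + 1)) (m b) c
      (settle.eval σ) ∧ (settle.eval σ).reg 8 = σ.reg 8 := by
  have e : ¬ (n - p b = 0) := by omega
  -- Subtraction is truncated: two numbers are equal if and only if both differences vanish.
  have e' : ¬ (b.val - t.val = 0 ∧ t.val - b.val = 0) := by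
    have := fun e => hbt (Fin.ext e)
    omega
  have hm : ∀ a, (settle.eval σ).mem a =
      if a = n * n + n + b then p b + 1 else if a = n * n + b then u.val else σ.mem a := by
    intro a
    simp [settle, bid, block, eval, State.reg_setReg, State.mem_setReg, State.reg_setMem,
      State.mem_setMem, h.size, h.sink, h.owners, h.prices, h.bidder, h10, h11, e, e']
  have hb := b.isLt
  refine ⟨⟨?_, ?_, ?_, ?_, ?_, ?_, ?_, ?_, ?_, ?_, ?_⟩, ?_⟩
  case refine_9 =>
    intro v w
    have := index_lt v w
    rw [hm, if_neg (by omega), if_neg (by omega), h.adj]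
  case refine_10 =>
    intro v
    have := v.isLt
    rw [hm, if_neg (by omega), h.owner]
    by_cases hv : v = b
    · simp [hv]
    · simp [hv, Fin.val_inj]
  case refine_11 =>
    intro v
    by_cases hv : v = b
    · simp [hm, hv]
    · have := fun e => hv (Fin.ext e)
      rw [hm, if_neg (by omega), if_neg (by omega), h.price, Function.update_of_ne hv]
  all_goals simp [settle, bid, block, eval, State.reg_setReg, State.mem_setReg, State.reg_setMem,
      h.size, h.source, h.sink, h.agents, h.owners, h.prices, h.counter,
      h.owner, h10, h11, e, e']

theorem settle_deposit (h : Represents G s t k m p u c σ) (h10 : σ.reg 10 = t)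
    (h11 : σ.reg 11 = p t) (hp : p t < n) :
    (c < k → Represents G s t k m p s (c + 1) (settle.eval σ) ∧
      (settle.eval σ).reg 8 = σ.reg 8) ∧
    (k ≤ c → (settle.eval σ).reg 8 = 0 ∧ (settle.eval σ).reg 9 = 1) := by
  have e : ¬ (n - p t = 0) := by omega
  constructor
  · intro hck
    have e' : c + 1 - k = 0 := by omega
    have hm : (settle.eval σ).mem = σ.mem := by
      simp [settle, deposit, block, eval, State.reg_setReg, State.mem_setReg, h.size, h.sink,
        h.agents, h.counter, h10, h11, e, e']
    refine ⟨⟨?_, ?_, ?_, ?_, ?_, ?_, ?_, ?_, by rw [hm]; exact h.adj, by rw [hm]; exact h.owner,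
      by rw [hm]; exact h.price⟩, ?_⟩
    all_goals simp [settle, deposit, block, eval, State.reg_setReg, h.size, h.source, h.sink,
      h.agents, h.owners, h.prices, h.counter, h10, h11, e, e']
  · intro hck
    have e' : ¬ (c + 1 - k = 0) := by omega
    simp [settle, deposit, block, eval, State.reg_setReg, h.size, h.source, h.sink,
      h.agents, h.counter, h10, h11, e, e']

/-- The main loop of the algorithm. -/
def auction : Prog :=
  .loop 8 (.seq scan settle)

-- A bid adds 2 to twice the total price, while the indicator of `u ≠ s` grows by at most 1; a
-- deposit lowers that indicator. Hence `j` decreases in every round.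
open Classical in
theorem runs_auction (hst : s ≠ t) (hadj : ¬ G.Adj s t) (hA : G.Auction s t m p s 0)
    (hσ : Represents G s t k m p s 0 σ) (h8 : σ.reg 8 ≠ 0) :
    auction.Runs σ ((2 * (n * n) + 1) * (n * 20 + 51) + 1) fun σ' =>
      σ'.reg 9 = if G.NoCut k s t then 1 else 0 := by
  let I : ℕ → State → Prop := fun j τ =>
    (τ.reg 8 ≠ 0 ∧ ∃ m p u c, c ≤ k ∧ G.Auction s t m p u c ∧ Represents G s t k m p u c τ ∧
      j + 2 * ∑ v, p v = 2 * (n * n) + (if u = s then 0 else 1) + 1) ∨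
    (τ.reg 8 = 0 ∧ τ.reg 9 = if G.NoCut k s t then 1 else 0)
  have hsum : ∀ {m p u c}, G.Auction s t m p u c → ∑ v, p v ≤ n * n := by
    intro m p u c h
    refine (Finset.sum_le_card_nsmul _ _ n fun v _ => ?_).trans (by simp)
    simpa using h.price_le v
  have hs := hsum hA
  refine Runs.mono (K := (2 * (n * n) + 1 - 2 * ∑ v, p v) * (n * 20 + 50 + 1) + 1)
    (Runs.loop (K := n * 20 + 50) I ?_ _ (.inl ⟨h8, m, p, s, 0, Nat.zero_le k, hA, hσ, ?_⟩)) ?_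
    fun _ h => h
  · rintro j τ (⟨h8, m, p, u, c, hck, hA, hτ, hj⟩ | h)
    · refine .inr ⟨h8, Runs.mono (Runs.seq (runs_scan hτ) (K' := 30)
        (R := fun σ' => ∃ i < j, I i σ') ?_) (by omega) fun _ h => h⟩
      rintro ρ ⟨hmem, hreg, b, h10, h11, hb, hmin⟩
      have hρ := hτ.congr hmem hreg
      have hs := hsum hA
      refine Runs.of_loopFree (by simp [settle, bid, deposit, block, LoopFree])
        (by simp [settle, bid, deposit, block, cost]) ?_
      by_cases hp : p b < n
      · by_cases hbt : b = t
        · subst hbt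
          have hus : u ≠ s := by
            rintro rfl
            exact hb.elim (fun e => hst e.symm) hadj
          have hA' := hA.deposit hst hus (hb.resolve_left hA.bidder_ne_sink.symm)
          obtain ⟨h1, h2⟩ := settle_deposit hρ h10 h11 hp
          rcases lt_or_ge c k with hck | hck
          · obtain ⟨h3, h4⟩ := h1 hck
            rw [if_neg hus] at hj
            refine ⟨j - 1, by omega, .inl ⟨?_, m, p, s, c + 1, hck, hA', h3, ?_⟩⟩
            · rwa [h4, hreg 8 (by decide)]
            · rw [if_pos rfl]; omega
          -- Here `c = k`, so this deposit completes path number `k + 1`.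
          · obtain ⟨h3, h4⟩ := h2 hck
            exact ⟨0, by omega, .inr ⟨h3, by rw [h4, if_pos (hA'.noCut (by omega))]⟩⟩
        · obtain ⟨h3, h4⟩ := settle_bid hρ h10 h11 hp hbt
          have hA' := hA.bid hb hbt hmin (by simpa using hp)
          have hs' := hsum hA'
          have hsum' : ∑ v, Function.update p b (p b + 1) v = ∑ v, p v + 1 := by
            rw [Finset.sum_update_of_mem (Finset.mem_univ b), Finset.sdiff_singleton_eq_erase,
              ← Finset.add_sum_erase _ p (Finset.mem_univ b)]
            omega
          rw [hsum'] at hs'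
          refine ⟨2 * (n * n) + (if m b = s then 0 else 1) + 1 - 2 * (∑ v, p v + 1), ?_,
            .inl ⟨?_, _, _, _, c, hck, hA', h3, ?_⟩⟩
          · split_ifs at hj ⊢ <;> omega
          · rwa [h4, hreg 8 (by decide)]
          · rw [hsum']; omega
      · obtain ⟨h3, h4⟩ := settle_fail hρ h11 (by omega)
        refine ⟨0, by omega, .inr ⟨h3, ?_⟩⟩
        rw [h4, if_neg (hA.not_noCut hst hck fun w hw => ?_)]
        have := hmin w hw
        rw [Fintype.card_fin]
        omega
    · exact .inl h
  · rw [if_pos rfl]; omega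
  · exact Nat.add_le_add_right (Nat.mul_le_mul_right _ (Nat.sub_le _ _)) 1

/-! ### Initialization and the complete decision program -/

/-- Make every vertex its own owner. -/
def initOwners : Prog :=
  .loop 12 (block [.const 17 1, .sub 12 12 17, .add 15 4 12, .store 15 12])

theorem runs_initOwners (σ : State) : initOwners.Runs σ (σ.reg 12 * 6 + 1) fun τ =>
    (∀ r < 10, τ.reg r = σ.reg r) ∧ ∀ a, τ.mem a =
      if σ.reg 4 ≤ a ∧ a < σ.reg 4 + σ.reg 12 then a - σ.reg 4 else σ.mem a := by
  refine Runs.loop (K := 5) (fun j τ => τ.reg 12 = j ∧ j ≤ σ.reg 12 ∧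
    (∀ r < 10, τ.reg r = σ.reg r) ∧ ∀ a, τ.mem a =
      if σ.reg 4 + j ≤ a ∧ a < σ.reg 4 + σ.reg 12 then a - σ.reg 4 else σ.mem a) ?_ _
    ⟨rfl, le_rfl, fun _ _ => rfl, fun a => by rw [if_neg (by omega)]⟩
  rintro j τ ⟨h12, hj, hreg, hmem⟩
  rcases j with _ | j
  · exact .inl ⟨h12, hreg, hmem⟩
  · have h4 := hreg 4 (by decide)
    refine .inr ⟨by omega, Runs.of_loopFree (by simp [block, LoopFree]) (by simp [block, cost])
      ⟨j, Nat.lt_succ_self j, ?_, by omega, fun r hr => ?_, fun a => ?_⟩⟩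
    · simp [block, eval, State.reg_setReg, State.reg_setMem, h12]
    · exact (Preserves.reg_eval (by simp [block, Preserves]; omega) τ).trans (hreg r hr)
    · simp only [block, eval, State.reg_setReg, State.mem_setReg,
        State.mem_setMem, h12, h4, hmem]
      simp
      split_ifs <;> omega

/-- Set up the data of the auction. -/
def setup : Prog :=
  .seq (block [.const 4 0, .copy 12 0]) <| .seq (addMul 4 12) <|
    .seq (block [.add 5 4 0, .copy 12 0]) <| .seq initOwners <|
      block [.add 15 5 1, .store 15 0, .copy 6 1, .const 7 0, .const 8 1]

theorem runs_setup (h0 : σ.reg 0 = n) (h1 : σ.reg 1 = s) (h2 : σ.reg 2 = t) (h3 : σ.reg 3 = k)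
    (hadj : ∀ v w : Fin n, (σ.mem (v * n + w) = 0 ↔ ¬ G.Adj v w))
    (hmem : ∀ a, n * n ≤ a → σ.mem a = 0) :
    setup.Runs σ (n * 11 + 14) fun τ => τ.reg 8 ≠ 0 ∧
      Represents G s t k (fun v => v) (Function.update (fun _ => 0) s n) s 0 τ := by
  refine Runs.mono (K := 3 + ((n * 5 + 1) + (3 + ((n * 6 + 1) + 6)))) ?_ (by omega) fun _ h => h
  refine Runs.seq (Q := fun τ => τ.mem = σ.mem ∧ τ.reg 4 = 0 ∧ τ.reg 12 = n ∧
    ∀ r < 4, τ.reg r = σ.reg r) (Runs.of_loopFree (by simp [block, LoopFree])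
    (by simp [block, cost]) ⟨rfl, ?_, ?_, fun r hr => ?_⟩) ?_
  · simp [block, eval, State.reg_setReg]
  · simp [block, eval, State.reg_setReg, h0]
  · exact Preserves.reg_eval (by simp [block, Preserves]; omega) σ
  rintro τ ⟨hm1, h4, h12, hr1⟩
  refine Runs.seq (Q := fun τ => τ.mem = σ.mem ∧ τ.reg 4 = n * n ∧ ∀ r < 4, τ.reg r = σ.reg r)
    (Runs.mono (runs_addMul (by decide) (by decide) (by decide) (by decide) (by decide) τ)
      (by rw [h12]) ?_) ?_
  · rintro ρ ⟨h5, h6, h7⟩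
    refine ⟨h5.trans hm1, by rw [h6, h4, h12, hr1 0 (by decide), h0, zero_add], fun r hr => ?_⟩
    rw [h7 r (by omega) (by omega) (by omega), hr1 r hr]
  clear! τ
  rintro τ ⟨hm1, h4, hr1⟩
  have h0' := (hr1 0 (by decide)).trans h0
  refine Runs.seq (Q := fun τ => τ.mem = σ.mem ∧ τ.reg 4 = n * n ∧ τ.reg 5 = n * n + n ∧
    τ.reg 12 = n ∧ ∀ r < 4, τ.reg r = σ.reg r) (Runs.of_loopFree (by simp [block, LoopFree])
    (by simp [block, cost]) ⟨hm1, ?_, ?_, ?_, fun r hr => ?_⟩) ?_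
  · simp [block, eval, State.reg_setReg, h4]
  · simp [block, eval, State.reg_setReg, h4, h0']
  · simp [block, eval, State.reg_setReg, h0']
  · exact (Preserves.reg_eval (by simp [block, Preserves]; omega) τ).trans (hr1 r hr)
  clear! τ
  rintro τ ⟨hm1, h4, h5, h12, hr1⟩
  refine Runs.seq (Runs.mono (runs_initOwners τ) (by rw [h12]) fun _ h => h) ?_
  rintro ρ ⟨hr2, hm2⟩
  have g0 := (hr2 0 (by decide)).trans ((hr1 0 (by decide)).trans h0)
  have g1 := (hr2 1 (by decide)).trans ((hr1 1 (by decide)).trans h1)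
  have g2 := (hr2 2 (by decide)).trans ((hr1 2 (by decide)).trans h2)
  have g3 := (hr2 3 (by decide)).trans ((hr1 3 (by decide)).trans h3)
  have g4 := (hr2 4 (by decide)).trans h4
  have g5 := (hr2 5 (by decide)).trans h5
  rw [h4, h12, hm1] at hm2
  refine Runs.of_loopFree (by simp [block, LoopFree]) (by simp [block, cost]) ⟨?_, ?_⟩
  · simp [block, eval, State.reg_setReg]
  have hm : ∀ a, ((block [.add 15 5 1, .store 15 0, .copy 6 1, .const 7 0, .const 8 1]).eval ρ).mem
      a = if a = n * n + n + s then n else ρ.mem a := by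
    intro a
    simp [block, eval, State.reg_setReg, State.mem_setReg, State.mem_setMem, g5, g1, g0]
  refine ⟨?_, ?_, ?_, ?_, ?_, ?_, ?_, ?_, ?_, ?_, ?_⟩
  case refine_9 =>
    intro v w
    have := index_lt v w
    rw [hm, hm2, if_neg (by omega), if_neg (by omega), hadj]
  case refine_10 =>
    intro v
    have := v.isLt
    rw [hm, hm2, if_neg (by omega), if_pos (by omega), Nat.add_sub_cancel_left]
  case refine_11 =>
    intro v
    by_cases hv : v = s
    · simp [hm, hv]
    · have := fun e => hv (Fin.ext e)
      rw [hm, hm2, if_neg (by omega), if_neg (by omega), hmem _ (by omega),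
        Function.update_of_ne hv]
  all_goals simp [block, eval, State.reg_setReg, State.reg_setMem, g0, g1, g2, g3, g4, g5]

/-- The program that decides whether `k` vertices can separate `s` and `t`. -/
def solver : Prog :=
  .seq (block [.sub 15 1 2, .sub 16 2 1, .add 15 15 16]) <|
    .ite 15
      (.seq (block [.copy 13 1, .copy 12 2]) <| .seq (addMul 13 12) <| .seq (.load 15 13) <|
        .ite 15 (.const 0 1) <| .seq setup <| .seq auction <| .copy 0 9)
      (.const 0 1)

theorem input_mem_eq_zero (v w : Fin n) :
    (input G s t k).mem (v * n + w) = 0 ↔ ¬ G.Adj v w := by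
  have hn : 0 < n := v.pos
  simp only [input, ite_eq_right_iff, one_ne_zero, imp_false, not_exists, not_and]
  refine ⟨fun h => h v w rfl, ?_⟩
  rintro h v' w' e
  have hw : w = w' := by
    have := congrArg (· % n) e
    simp only [Nat.mul_add_mod', Nat.mod_eq_of_lt w.isLt, Nat.mod_eq_of_lt w'.isLt] at this
    exact Fin.ext this
  subst hw
  have hv : v = v' := Fin.ext (Nat.eq_of_mul_eq_mul_right hn (Nat.add_right_cancel e))
  rwa [← hv]

-- Equal or adjacent `s` and `t` are never separated, and the auction needs them distinct and
-- nonadjacent. The bound is free of `k`, which is only compared with the number of paths.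
open Classical in
theorem runs_solver (G : SimpleGraph (Fin n)) (s t : Fin n) (k : ℕ) :
    solver.Runs (input G s t k) ((2 * (n * n) + 1) * (n * 20 + 51) + n * 16 + 30) fun σ =>
      σ.reg 0 = if G.NoCut k s t then 1 else 0 := by
  have hr : (input G s t k).reg 0 = n ∧ (input G s t k).reg 1 = s ∧ (input G s t k).reg 2 = t ∧
    (input G s t k).reg 3 = k := ⟨rfl, rfl, rfl, rfl⟩
  have hadj := input_mem_eq_zero (G := G) (s := s) (t := t) (k := k)
  have hmem : ∀ a, n * n ≤ a → (input G s t k).mem a = 0 := by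
    intro a ha
    simp only [input, ite_eq_right_iff, one_ne_zero, imp_false, not_exists, not_and]
    rintro v w rfl
    have := index_lt v w
    omega
  generalize input G s t k = σ at hr hadj hmem
  obtain ⟨h0, h1, h2, h3⟩ := hr
  have one : ∀ {τ : State} {K : ℕ}, G.NoCut k s t → 1 ≤ K → (Prog.const 0 1).Runs τ K fun σ =>
      σ.reg 0 = if G.NoCut k s t then 1 else 0 := fun h hK =>
    Runs.of_loopFree (by simp [LoopFree]) hK (by simp [eval, State.reg_setReg, h])
  refine Runs.mono (K := 4 + (3 + ((n * 5 + 1) + (1 + ((n * 11 + 14) +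
    (((2 * (n * n) + 1) * (n * 20 + 51) + 1) + 1) + 1))) + 1)) ?_ (by omega) fun _ h => h
  refine Runs.seq (Q := fun τ => τ.mem = σ.mem ∧ τ.reg 15 = s.val - t.val + (t.val - s.val) ∧
    ∀ r < 10, τ.reg r = σ.reg r) (Runs.of_loopFree (by simp [block, LoopFree])
    (by simp [block, cost]) ⟨rfl, ?_, fun r hr => ?_⟩) ?_
  · simp [block, eval, State.reg_setReg, h1, h2]
  · exact Preserves.reg_eval (by simp [block, Preserves]; omega) σ
  rintro τ ⟨hm1, h15, hr1⟩
  refine Runs.ite (fun hx => ?_) fun hx => ?_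
  swap
  · obtain rfl : s = t := Fin.ext (by omega)
    exact one NoCut.refl (by omega)
  have hst : s ≠ t := by
    rintro rfl
    exact hx (by simp [h15])
  refine Runs.seq (Q := fun ρ => ρ.mem = σ.mem ∧ ρ.reg 13 = s ∧ ρ.reg 12 = t ∧
    ∀ r < 10, ρ.reg r = σ.reg r) (Runs.of_loopFree (by simp [block, LoopFree])
    (by simp [block, cost]) ⟨hm1, ?_, ?_, fun r hr => ?_⟩) ?_
  · simp [block, eval, State.reg_setReg, hr1, h1]
  · simp [block, eval, State.reg_setReg, hr1, h2]
  · exact (Preserves.reg_eval (by simp [block, Preserves]; omega) τ).trans (hr1 r hr)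
  clear! τ
  rintro τ ⟨hm1, h13, h12, hr1⟩
  refine Runs.seq (Q := fun ρ => ρ.mem = σ.mem ∧ ρ.reg 13 = t.val * n + s.val ∧
    ∀ r < 10, ρ.reg r = σ.reg r) (Runs.mono
    (runs_addMul (by decide) (by decide) (by decide) (by decide) (by decide) τ) ?_ ?_) ?_
  · have := t.isLt
    rw [h12]
    omega
  · rintro ρ ⟨h4, h5, h6⟩
    refine ⟨h4.trans hm1, ?_, fun r hr => ?_⟩
    · rw [h5, h13, h12, hr1 0 (by decide), h0, Nat.add_comm]
    · rw [h6 r (by omega) (by omega) (by omega), hr1 r hr]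
  clear! τ
  rintro τ ⟨hm1, h13, hr1⟩
  refine Runs.seq (Q := fun ρ => ρ.mem = σ.mem ∧ ρ.reg 15 = σ.mem (t.val * n + s.val) ∧
    ∀ r < 10, ρ.reg r = σ.reg r) (Runs.of_loopFree (by simp [LoopFree])
    (by simp [cost]) ⟨hm1, ?_, fun r hr => ?_⟩) ?_
  · simp [eval, State.reg_setReg, h13, hm1]
  · exact (Preserves.reg_eval (by simp [Preserves]; omega) τ).trans (hr1 r hr)
  clear! τ
  rintro τ ⟨hm1, h15, hr1⟩
  refine Runs.ite (fun hx => ?_) fun hx => ?_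
  · rw [h15, ne_eq, hadj, not_not] at hx
    exact one (NoCut.of_adj hx.symm) (by omega)
  have hnadj : ¬ G.Adj s t := by
    rwa [G.adj_comm, ← hadj, ← h15]
  refine Runs.seq (runs_setup (G := G) (s := s) (t := t) (k := k) ((hr1 0 (by decide)).trans h0)
    ((hr1 1 (by decide)).trans h1) ((hr1 2 (by decide)).trans h2) ((hr1 3 (by decide)).trans h3)
    (by rwa [hm1]) (by rwa [hm1])) ?_
  rintro ρ ⟨h8, hρ⟩
  have hA := Auction.init (G := G) hst
  rw [Fintype.card_fin] at hA
  refine Runs.seq (runs_auction hst hnadj hA hρ h8) fun π hπ => ?_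
  exact Runs.of_loopFree (by simp [LoopFree]) (by simp [cost]) (by
    simp [eval, State.reg_setReg, hπ])

theorem solvable_of_forall_noCut (C : ∀ n : ℕ, SimpleGraph (Fin n) → Prop)
    (hC : ∀ (n : ℕ) (G : SimpleGraph (Fin n)) (s t : Fin n) (k : ℕ), C n G → G.NoCut k s t →
      FacilitatorWins G s t k) : SolvableInPolyTimeOn C := by
  classical
  -- Bounding both `n` and `n * n` by the input size turns the cubic bound in `n` into a quadratic
  -- one; 500 is generous.
  refine ⟨solver, 500 * (Polynomial.X + 1) ^ 2, fun n G s t k hG hCG _ => ?_⟩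
  obtain ⟨T, hT, σ, hσ, h⟩ := runs_solver G s t k
  refine ⟨T, σ, hσ, hT.trans ?_, ?_⟩
  · have h1 : n * n ≤ inputSize s t k := by
      simp only [inputSize, pow_two]
      omega
    have h2 : n ≤ inputSize s t k := (Nat.le_mul_self n).trans h1
    generalize inputSize s t k = N at h1 h2
    simp only [Polynomial.eval_mul, Polynomial.eval_pow, Polynomial.eval_add, Polynomial.eval_X,
      Polynomial.eval_one, Polynomial.eval_ofNat]
    calc (2 * (n * n) + 1) * (n * 20 + 51) + n * 16 + 30
        ≤ (2 * N + 1) * (N * 20 + 51) + N * 16 + 30 := by gcongr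
      _ ≤ 500 * (N + 1) ^ 2 := by nlinarith
  · rw [h]
    have : G.NoCut k s t ↔ FacilitatorWins G s t k :=
      ⟨hC n G s t k hCG, fun h => h.noCut hG⟩
    simp only [this]

end Rendezvous

theorem corollary5 :
    Rendezvous.SolvableInPolyTimeOn (fun _ G => G.P5Free) ∧
      Rendezvous.SolvableInPolyTimeOn (fun _ G => G.Chordal) :=
  ⟨Rendezvous.solvable_of_forall_noCut _ fun _ _ _ _ _ hG h =>
      Rendezvous.facilitatorWins_of_P5Free hG h,
    Rendezvous.solvable_of_forall_noCut _ fun _ _ _ _ _ hG h =>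
      Rendezvous.facilitatorWins_of_chordal hG h⟩
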